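/- Let $n\ge 1$, let $\overline X$ be a compact smooth manifold of dimension $n+1$ with nonempty boundary $M=\partial\overline X$ and interior $X$, and let $g_+$ be an asymptotically hyperbolic metric on $X$. That is: (i) $g_+$ is conformally compact: there are a defining function $r$ of $M$ (a $C^2$ function on $\overline X$ with $r>0$ on $X$, $r=0$ on $M$ and $dr\neq 0$ on $M$) and a $C^2$ Riemannian metric $\overline g$ on $\overline X$ with $\overline g=r^2g_+$ on $X$ (so $g_+$ is a complete Riemannian metric on $X$; this covers in particular compactifications of class $C^{3,\alpha}$); (ii) the sectional curvatures of $g_+$ tend to $-1$ at $M$, uniformly over points and $2$-planes. For $1<p<\infty$ and a bounded domain $\Omega\subset X$ with smooth boundary (equivalently, a nonempty connected open set with smooth boundary whose closure is a compact subset of $X$), put $$\lambda_{1,p}(\Omega)=\inf_{f\in W^{1,p}_0(\Omega),\,f\neq0}\frac{\int_\Omega|\nabla_{g_+}f|^p\,dv_{g_+}}{\int_\Omega|f|^p\,dv_{g_+}},$$ where $W^{1,p}_0(\Omega)$ is the completion of $C_c^\infty(\Omega)$ in the Sobolev norm of $g_+$. Let the first Dirichlet eigenvalue of the $p$-Laplacian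 on $X$ be $$\lambda_{1,p}(X)=\inf_\Omega\lambda_{1,p}(\Omega),$$ the infimum being over all bounded domains $\Omega$ of $X$ with smooth boundary. Then for every $1<p<\infty$, $$\lambda_{1,p}(X)\le\left(\frac np\right)^p .$$ -/

import Mathlib

open Set Filter Topology MeasureTheory
open scoped Manifold ContDiff ENNReal

noncomputable section

namespace AHEigenvalue

/-- The coordinate space of dimension `n + 1`. -/
abbrev E (n : ℕ) : Type := EuclideanSpace ℝ (Fin (n + 1))

/-- The `i`-th coordinate vector. -/
def e {n : ℕ} (i : Fin (n + 1)) : E n := EuclideanSpace.single i 1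

section Charts

variable {n : ℕ} {Xbar : Type*} [TopologicalSpace Xbar]
  [ChartedSpace (EuclideanHalfSpace (n + 1)) Xbar]

variable (n Xbar) in
/-- A field of bilinear forms on the tangent spaces of `Xbar`. A Riemannian metric on the interior
`X` of `Xbar` is represented by such a field; its values at boundary points are never used. -/
abbrev BilinField : Type _ :=
  ∀ x : Xbar, TangentSpace (𝓡∂ (n + 1)) x →L[ℝ] TangentSpace (𝓡∂ (n + 1)) x →L[ℝ] ℝ

/-- The coefficients `g_{ij}(y) = g(∂_i, ∂_j)` in the chart about `c`, at the coordinate point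
`y`. -/
def coeff (g : BilinField n Xbar) (c : Xbar) (i j : Fin (n + 1)) (y : E n) : ℝ :=
  g ((extChartAt (𝓡∂ (n + 1)) c).symm y)
    (mfderivWithin 𝓘(ℝ, E n) (𝓡∂ (n + 1)) (extChartAt (𝓡∂ (n + 1)) c).symm
      (range (𝓡∂ (n + 1))) y (e i))
    (mfderivWithin 𝓘(ℝ, E n) (𝓡∂ (n + 1)) (extChartAt (𝓡∂ (n + 1)) c).symm
      (range (𝓡∂ (n + 1))) y (e j))

/-- The matrix `(g_{ij}(y))` in the chart about `c`. -/
def gram (g : BilinField n Xbar) (c : Xbar) (y : E n) : Matrix (Fin (n + 1)) (Fin (n + 1)) ℝ :=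
  Matrix.of fun i j => coeff g c i j y

/-- Partial derivative in the `i`-th coordinate direction. -/
def pd (i : Fin (n + 1)) (f : E n → ℝ) (y : E n) : ℝ := fderiv ℝ f y (e i)

/-- Christoffel symbols
`Γ^k_{ij} = (1/2) ∑_l g^{kl} (∂_i g_{jl} + ∂_j g_{il} - ∂_l g_{ij})`. -/
def christoffel (g : BilinField n Xbar) (c : Xbar) (k i j : Fin (n + 1)) (y : E n) : ℝ :=
  (1 / 2) * ∑ l, (gram g c y)⁻¹ k l *
    (pd i (coeff g c j l) y + pd j (coeff g c i l) y - pd l (coeff g c i j) y)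

/-- Components of the curvature tensor: `R(∂_i, ∂_j) ∂_k = ∑_l R^l_{ijk} ∂_l`, where
`R(U, V) W = ∇_U ∇_V W - ∇_V ∇_U W - ∇_{[U,V]} W`. -/
def riemann (g : BilinField n Xbar) (c : Xbar) (l i j k : Fin (n + 1)) (y : E n) : ℝ :=
  pd i (christoffel g c l j k) y - pd j (christoffel g c l i k) y
    + ∑ m, (christoffel g c l i m y * christoffel g c m j k y
      - christoffel g c l j m y * christoffel g c m i k y)

/-- The inner product of two coordinate vectors at the coordinate point `y`. -/
def chartInner (g : BilinField n Xbar) (c : Xbar) (y u v : E n) : ℝ :=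
  ∑ i, ∑ j, coeff g c i j y * u i * v j

/-- The sectional curvature
`g(R(u, v) v, u) / (g(u, u) g(v, v) - g(u, v)²)` of the plane spanned by the linearly independent
vectors `u = ∑ u^i ∂_i` and `v = ∑ v^i ∂_i` at the point with coordinates `y` in the chart
about `c`. -/
def sectional (g : BilinField n Xbar) (c : Xbar) (y u v : E n) : ℝ :=
  (∑ i, ∑ j, ∑ k, ∑ l, ∑ m,
      riemann g c l i j k y * u i * v j * v k * coeff g c l m y * u m) /
    (chartInner g c y u u * chartInner g c y v v - chartInner g c y u v ^ 2)

/-- The Riemannian volume measure. In the chart about `c` it is `√det(g_{ij}) dy`; these measures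
agree on overlaps of charts, and their supremum is the measure that restricts to each of them. -/
def vol [MeasurableSpace Xbar] (g : BilinField n Xbar) : Measure Xbar :=
  ⨆ c : Xbar, Measure.map (extChartAt (𝓡∂ (n + 1)) c).symm
    (((volume : Measure (E n)).restrict (extChartAt (𝓡∂ (n + 1)) c).target).withDensity
      fun y => ENNReal.ofReal (Real.sqrt (gram g c y).det))

variable (n) in
/-- A field of covectors. -/
abbrev CovField (Xbar : Type*) [TopologicalSpace Xbar]
    [ChartedSpace (EuclideanHalfSpace (n + 1)) Xbar] : Type _ :=
  ∀ x : Xbar, TangentSpace (𝓡∂ (n + 1)) x →L[ℝ] ℝ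

/-- The differential of a function, as a field of covectors. -/
def diff (f : Xbar → ℝ) : CovField n Xbar := fun x => mfderiv (𝓡∂ (n + 1)) 𝓘(ℝ, ℝ) f x

/-- The norm `|α|_g = sup {|α(v)| : g(v, v) ≤ 1}` of a covector at `x`. For `α = df` this is the
norm `|∇f|_g` of the gradient. -/
def covNorm (g : BilinField n Xbar) (x : Xbar) (α : TangentSpace (𝓡∂ (n + 1)) x →L[ℝ] ℝ) : ℝ≥0∞ :=
  ⨆ v : {v : TangentSpace (𝓡∂ (n + 1)) x // g x v v ≤ 1}, ENNReal.ofReal |α v.1|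

variable (n) in
/-- `φ` is a smooth function with compact support in `Ω`. (The space `Xbar` will be compact, so
that the closed set `tsupport φ` is compact.) -/
def IsTestFunction (Ω : Set Xbar) (φ : Xbar → ℝ) : Prop :=
  ContMDiff (𝓡∂ (n + 1)) 𝓘(ℝ, ℝ) ∞ φ ∧ HasCompactSupport φ ∧ tsupport φ ⊆ Ω

/-- `f` lies in `W_0^{1,p}(Ω)`, the closure of the test functions in the Sobolev norm, and `V` is
its weak differential: there are test functions `φ_k` with `φ_k → f` and `dφ_k → V` in
`L^p(Ω, g)`. -/
structure MemW0 [MeasurableSpace Xbar] (g : BilinField n Xbar) (p : ℝ) (Ω : Set Xbar)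
    (f : Xbar → ℝ) (V : CovField n Xbar) : Prop where
  aemeasurable : AEMeasurable f ((vol g).restrict Ω)
  exists_approx : ∃ φ : ℕ → Xbar → ℝ,
    (∀ k, IsTestFunction n Ω (φ k)) ∧
    Tendsto (fun k => ∫⁻ x in Ω, ‖φ k x - f x‖ₑ ^ p ∂(vol g)) atTop (𝓝 0) ∧
    (∀ k, AEMeasurable (fun x => covNorm g x (diff (φ k) x - V x)) ((vol g).restrict Ω)) ∧
    Tendsto (fun k => ∫⁻ x in Ω, covNorm g x (diff (φ k) x - V x) ^ p ∂(vol g)) atTop (𝓝 0)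

/-- The first `p`-Dirichlet eigenvalue of `Ω`: the infimum of the Rayleigh quotients
`∫_Ω |∇f|^p dv / ∫_Ω |f|^p dv` over the nonzero `f` in `W_0^{1,p}(Ω)`. -/
def eigenvalueOn [MeasurableSpace Xbar] (g : BilinField n Xbar) (p : ℝ) (Ω : Set Xbar) : ℝ≥0∞ :=
  ⨅ (f : Xbar → ℝ) (V : CovField n Xbar) (_ : MemW0 g p Ω f V)
    (_ : ∫⁻ x in Ω, ‖f x‖ₑ ^ p ∂(vol g) ≠ 0),
    (∫⁻ x in Ω, covNorm g x (V x) ^ p ∂(vol g)) / ∫⁻ x in Ω, ‖f x‖ₑ ^ p ∂(vol g)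

variable (n) in
/-- `Ω` is a bounded domain with smooth boundary in the interior `X` of `Xbar`: a connected
nonempty open set with compact closure contained in `X` which near each of its boundary points is a
sublevel set `{ρ < 0}` of a smooth function `ρ` with `dρ ≠ 0` at that point. (For a complete
metric on `X`, a set is bounded exactly if it has compact closure in `X`.) -/
structure IsSmoothBoundedDomain (Ω : Set Xbar) : Prop where
  isOpen : IsOpen Ω
  isConnected : IsConnected Ω
  isCompact_closure : IsCompact (closure Ω)
  closure_subset : closure Ω ⊆ (𝓡∂ (n + 1)).interior Xbar
  smooth_boundary : ∀ x ∈ frontier Ω, ∃ (U : Set Xbar) (ρ : Xbar → ℝ),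
    IsOpen U ∧ x ∈ U ∧ ContMDiffOn (𝓡∂ (n + 1)) 𝓘(ℝ, ℝ) ∞ ρ U ∧
    ρ x = 0 ∧ mfderiv (𝓡∂ (n + 1)) 𝓘(ℝ, ℝ) ρ x ≠ 0 ∧ Ω ∩ U = {y ∈ U | ρ y < 0}

/-- The first `p`-Dirichlet eigenvalue `λ_{1,p}(X)` of the interior `X` of `Xbar` with the
metric `g`: the infimum of `λ_{1,p}(Ω)` over all bounded domains `Ω` of `X` with smooth boundary. -/
def firstEigenvalue [MeasurableSpace Xbar] (g : BilinField n Xbar) (p : ℝ) : ℝ≥0∞ :=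
  ⨅ (Ω : Set Xbar) (_ : IsSmoothBoundedDomain n Ω), eigenvalueOn g p Ω

variable (n) in
/-- `r` is a `C²` defining function for the boundary of `Xbar`. -/
structure IsDefiningFunction (r : Xbar → ℝ) : Prop where
  contMDiff : ContMDiff (𝓡∂ (n + 1)) 𝓘(ℝ, ℝ) 2 r
  pos : ∀ x ∈ (𝓡∂ (n + 1)).interior Xbar, 0 < r x
  zero : ∀ x ∈ (𝓡∂ (n + 1)).boundary Xbar, r x = 0
  mfderiv_ne_zero : ∀ x ∈ (𝓡∂ (n + 1)).boundary Xbar, mfderiv (𝓡∂ (n + 1)) 𝓘(ℝ, ℝ) r x ≠ 0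

/-- `g` is conformally compact: for some defining function `r`, the field `r² g` on the
interior `X` extends to a `C²` Riemannian metric on `Xbar`. (So `g` is a Riemannian metric on
`X`; when `Xbar` is compact, `g` is complete.) -/
def IsConformallyCompact [IsManifold (𝓡∂ (n + 1)) ∞ Xbar] (g : BilinField n Xbar) : Prop :=
  ∃ (r : Xbar → ℝ)
    (gbar : Bundle.ContMDiffRiemannianMetric (𝓡∂ (n + 1)) 2 (E n)
      (TangentSpace (𝓡∂ (n + 1)) : Xbar → Type _)),
    IsDefiningFunction n r ∧
      ∀ x ∈ (𝓡∂ (n + 1)).interior Xbar, ∀ u v : TangentSpace (𝓡∂ (n + 1)) x,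
        gbar.inner x u v = r x ^ 2 * g x u v

/-- The sectional curvatures of `g` approach `-1` at the boundary, uniformly. The sectional
curvature at `x` may be computed in any chart containing `x`. -/
def CurvatureTendsToNegOne (g : BilinField n Xbar) : Prop :=
  ∀ ε : ℝ, 0 < ε → ∃ U : Set Xbar, IsOpen U ∧ (𝓡∂ (n + 1)).boundary Xbar ⊆ U ∧
    ∀ c x : Xbar, x ∈ U → x ∈ (𝓡∂ (n + 1)).interior Xbar →
      x ∈ (extChartAt (𝓡∂ (n + 1)) c).source →
      ∀ u v : E n, LinearIndependent ℝ ![u, v] →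
        |sectional g c (extChartAt (𝓡∂ (n + 1)) c x) u v - (-1)| < ε

/-- Asymptotically hyperbolic metrics. -/
structure IsAsymptoticallyHyperbolic [IsManifold (𝓡∂ (n + 1)) ∞ Xbar] (g : BilinField n Xbar) :
    Prop where
  conformallyCompact : IsConformallyCompact g
  curvature : CurvatureTendsToNegOne g

end Charts

end AHEigenvalue

end

/-!
The infimum defining `firstEigenvalue` may be tested on functions concentrated near one boundary
point, where the metric is close to the hyperbolic metric of the half space; there the power
`t ^ (n / p)` of the height `t` just fails to be `p`-integrable and is an almost-minimizer.

Let `x` be a boundary point and write `g = gbar / r ^ 2` in the chart about `x`. In the formula for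
the sectional curvature of `g`, the terms of order zero in `r` give `-|dr|²` as the boundary is
approached, and every other term carries a factor `r` (`tendsto_sectional`; this needs two
derivatives of `gbar` and of `r` only). Since the curvatures tend to `-1`, the length of `dr` for
`gbar` is at most `1` at `x` (`sq_fderivWithin_defining_le`), and this inequality is all that is used
of the curvature condition.

As `r` vanishes on the boundary, its differential at `x` is `b dy⁰` with `b > 0`. So close to `x`,
on a sector `y⁰ ≥ c |y - x|` with fixed `c > 0`, the function `r` is `b y⁰` up to a factor near `1`,
and `gbar` is nearly constant. In the coordinates `y = x + σ (t, w¹, …, wⁿ)`, `t = exp (L (w⁰ - 2))`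
(`logDiffeo`), the volume measure of `g` is `K t⁻ⁿ dw` up to factors close to `1`, and the gradient
of `t ^ (n / p) B(w)` is at most `t ^ (n / p) (n / p * B(w) + small)` if `L` is large and then
`σ` is small, for any bump function `B`. The powers of `t` cancel in both integrals of the Rayleigh
quotient (`firstEigenvalue_le_of_bump`), which tends to
`(n / p) ^ p ∫ B ^ p / ∫ B ^ p = (n / p) ^ p`.

Transferring the integrals to the coordinates needs the volume measure, a supremum over charts, to
agree with `√det g dy` in each single chart (`vol_restrict_image`). The domain on which the Rayleigh
quotient is taken is the image of a ball under the coordinates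
(`HalfSpaceDiffeo.firstEigenvalue_le`).
-/

namespace AHEigenvalue

/-! ### The chart about a point -/

section ChartFacts

variable {n : ℕ} {Xbar : Type*} [TopologicalSpace Xbar]
  [ChartedSpace (EuclideanHalfSpace (n + 1)) Xbar]

/-- The derivative of the inverse of the chart about `c` at the coordinate point `y`; it sends
the `i`-th coordinate vector to `∂_i`. -/
noncomputable abbrev dsymm (c : Xbar) (y : E n) :
    E n →L[ℝ] TangentSpace (𝓡∂ (n + 1)) ((extChartAt (𝓡∂ (n + 1)) c).symm y) :=
  mfderivWithin 𝓘(ℝ, E n) (𝓡∂ (n + 1)) (extChartAt (𝓡∂ (n + 1)) c).symm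
    (range (𝓡∂ (n + 1))) y

lemma sum_smul_e (v : E n) : ∑ i, v i • (e i : E n) = v := by
  ext j
  simp [e, Pi.single_apply]

lemma chartInner_eq (g : BilinField n Xbar) (c : Xbar) (y u v : E n) :
    chartInner g c y u v =
      g ((extChartAt (𝓡∂ (n + 1)) c).symm y) (dsymm c y u) (dsymm c y v) := by
  conv_rhs => rw [← sum_smul_e u, ← sum_smul_e v]
  simp only [map_sum, map_smul, sum_apply,
    smul_apply, smul_eq_mul, chartInner, coeff, Finset.mul_sum]
  rw [Finset.sum_comm]
  refine Finset.sum_congr rfl fun i _ => Finset.sum_congr rfl fun j _ => ?_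
  rw [mul_assoc, mul_comm, mul_comm (u j), mul_assoc]
  rfl

lemma isOpen_target_inter (c : Xbar) :
    IsOpen ((extChartAt (𝓡∂ (n + 1)) c).target ∩ {y : E n | 0 < y 0}) := by
  rw [extChartAt_target, inter_right_comm, inter_assoc]
  have : {y : E n | 0 < y 0} ∩ range (𝓡∂ (n + 1)) = {y : E n | 0 < y 0} := by
    rw [range_modelWithCornersEuclideanHalfSpace]
    exact inter_eq_left.2 fun y (hy : 0 < y 0) => hy.le
  have h1 : IsOpen {y : E n | 0 < y 0} := isOpen_lt continuous_const (by fun_prop)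
  have h2 : (𝓡∂ (n + 1)).symm ⁻¹' (chartAt (EuclideanHalfSpace (n + 1)) c).target ∩
      ({y : E n | 0 < y 0} ∩ range (𝓡∂ (n + 1))) =
      (𝓡∂ (n + 1)).symm ⁻¹' (chartAt (EuclideanHalfSpace (n + 1)) c).target ∩
      {y : E n | 0 < y 0} := by rw [this]
  rw [h2]
  exact ((chartAt (EuclideanHalfSpace (n + 1)) c).open_target.preimage
    (𝓡∂ (n + 1)).continuous_symm).inter h1

variable [IsManifold (𝓡∂ (n + 1)) ∞ Xbar]

lemma mem_interior_iff_of_mem_source {c x : Xbar}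
    (hx : x ∈ (extChartAt (𝓡∂ (n + 1)) c).source) :
    x ∈ (𝓡∂ (n + 1)).interior Xbar ↔ 0 < extChartAt (𝓡∂ (n + 1)) c x 0 := by
  have hx' : x ∈ (chartAt (EuclideanHalfSpace (n + 1)) c).source := by
    simpa using hx
  have h := (𝓡∂ (n + 1)).isInteriorPoint_iff_of_mem_atlas (n := ∞) (by simp)
    (chart_mem_atlas (EuclideanHalfSpace (n + 1)) c) hx'
  have h2 : x ∈ (𝓡∂ (n + 1)).interior Xbar ↔ (𝓡∂ (n + 1)).IsInteriorPoint x := Iff.rfl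
  rw [h2, h]
  change extChartAt (𝓡∂ (n + 1)) c x ∈ interior (extChartAt (𝓡∂ (n + 1)) c).target ↔ _
  constructor
  · intro h
    have := interior_mono (extChartAt_target_subset_range c) h
    rwa [interior_range_modelWithCornersEuclideanHalfSpace] at this
  · intro h
    have h3 : extChartAt (𝓡∂ (n + 1)) c x ∈ interior (range (𝓡∂ (n + 1))) := by
      rwa [interior_range_modelWithCornersEuclideanHalfSpace]
    have h4 := extChartAt_target_mem_nhdsWithin' hx
    rw [nhdsWithin_eq_nhds.2 (mem_interior_iff_mem_nhds.1 h3)] at h4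
    exact mem_interior_iff_mem_nhds.2 h4

lemma symm_mem_interior_iff {c : Xbar} {y : E n}
    (hy : y ∈ (extChartAt (𝓡∂ (n + 1)) c).target) :
    (extChartAt (𝓡∂ (n + 1)) c).symm y ∈ (𝓡∂ (n + 1)).interior Xbar ↔ 0 < y 0 := by
  rw [mem_interior_iff_of_mem_source ((extChartAt (𝓡∂ (n + 1)) c).map_target hy),
    (extChartAt (𝓡∂ (n + 1)) c).right_inv hy]

lemma dsymm_injective {c : Xbar} {y : E n} (hy : y ∈ (extChartAt (𝓡∂ (n + 1)) c).target) :
    Function.Injective (dsymm c y) := by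
  have h := isInvertible_mfderivWithin_extChartAt_symm (I := 𝓡∂ (n + 1)) hy
  exact h.injective

lemma coeff_contDiffOn
    (gbar : Bundle.ContMDiffRiemannianMetric (𝓡∂ (n + 1)) 2 (E n)
      (TangentSpace (𝓡∂ (n + 1)) : Xbar → Type _)) (c : Xbar) (i j : Fin (n + 1)) :
    ContDiffOn ℝ 2 (coeff gbar.inner c i j) (extChartAt (𝓡∂ (n + 1)) c).target := by
  have : IsManifold (𝓡∂ (n + 1)) (2 + 1) Xbar := IsManifold.of_le (n := ∞) (by norm_cast)
  have : ContMDiffVectorBundle 2 (E n) (TangentSpace (𝓡∂ (n + 1)) : Xbar → Type _) (𝓡∂ (n + 1)) :=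
    TangentBundle.contMDiffVectorBundle
  have hs : ContMDiffOn 𝓘(ℝ, E n) (𝓡∂ (n + 1)) 2 (extChartAt (𝓡∂ (n + 1)) c).symm
      (extChartAt (𝓡∂ (n + 1)) c).target :=
    (contMDiffOn_extChartAt_symm (n := ∞) c).of_le (by norm_cast)
  let τ := trivializationAt (E n) (TangentSpace (𝓡∂ (n + 1)) : Xbar → Type _) c
  have hsec : ∀ v : E n, ContMDiffOn (𝓡∂ (n + 1)) ((𝓡∂ (n + 1)).prod 𝓘(ℝ, E n)) 2
      (fun x : Xbar => Bundle.TotalSpace.mk' (E n) x (τ.symmL ℝ x v)) τ.baseSet := by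
    intro v
    rw [τ.contMDiffOn_section_baseSet_iff]
    refine (contMDiffOn_const (c := v)).congr fun x hx => ?_
    rw [τ.symmL_apply hx, τ.apply_mk_symm hx]
  have h : ContMDiffOn (𝓡∂ (n + 1)) 𝓘(ℝ, ℝ) 2
      (fun x : Xbar => gbar.inner x (τ.symmL ℝ x (e i)) (τ.symmL ℝ x (e j))) τ.baseSet := by
    intro x hx
    have : ContMDiffWithinAt (𝓡∂ (n + 1)) ((𝓡∂ (n + 1)).prod 𝓘(ℝ, ℝ)) 2
        (fun x : Xbar => Bundle.TotalSpace.mk' ℝ (E := Bundle.Trivial Xbar ℝ) x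
          (gbar.inner x (τ.symmL ℝ x (e i)) (τ.symmL ℝ x (e j)))) τ.baseSet x :=
      ContMDiffWithinAt.clm_bundle_apply₂ (F₁ := E n) (F₂ := E n) (b := fun x => x)
        (gbar.contMDiff x).contMDiffWithinAt (hsec (e i) x hx) (hsec (e j) x hx)
    simp only [Bundle.contMDiffWithinAt_totalSpace] at this
    exact this.2
  rw [← contMDiffOn_iff_contDiffOn]
  have hb : τ.baseSet = (chartAt (EuclideanHalfSpace (n + 1)) c).source :=
    TangentBundle.trivializationAt_baseSet c
  refine (h.comp hs fun y hy => ?_).congr fun y hy => ?_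
  · rw [hb, ← extChartAt_source (𝓡∂ (n + 1))]
    exact (extChartAt (𝓡∂ (n + 1)) c).map_target hy
  · have hx : (extChartAt (𝓡∂ (n + 1)) c).symm y ∈
        (chartAt (EuclideanHalfSpace (n + 1)) c).source := by
      rw [← extChartAt_source (𝓡∂ (n + 1))]
      exact (extChartAt (𝓡∂ (n + 1)) c).map_target hy
    have h1 := TangentBundle.symmL_trivializationAt (I := 𝓡∂ (n + 1)) hx
    rw [(extChartAt (𝓡∂ (n + 1)) c).right_inv hy] at h1
    simp only [Function.comp, coeff, τ, h1]
    rfl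

end ChartFacts

/-! ### Curvature of a conformally compact metric at the boundary -/

section Curvature

variable {n : ℕ}

/-- The partial derivative within a set `T`; unlike `pd` it also makes sense at the points of the
boundary of a half-space. -/
noncomputable def pdWithin (T : Set (E n)) (i : Fin (n + 1)) (f : E n → ℝ) (y : E n) : ℝ :=
  fderivWithin ℝ f T y (e i)

lemma pd_eq_pdWithin {T : Set (E n)} {y : E n} (hT : T ∈ 𝓝 y) (i : Fin (n + 1)) (f : E n → ℝ) :
    pd i f y = pdWithin T i f y := by
  simp only [pd, pdWithin, fderivWithin_of_mem_nhds hT]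

lemma contDiffOn_pdWithin {T : Set (E n)} (hT : UniqueDiffOn ℝ T) {f : E n → ℝ} {m k : WithTop ℕ∞}
    (hf : ContDiffOn ℝ k f T) (hm : m + 1 ≤ k) (i : Fin (n + 1)) :
    ContDiffOn ℝ m (pdWithin T i f) T :=
  (hf.fderivWithin hT hm).clm_apply contDiffOn_const

lemma pd_congr {f₁ f₂ : E n → ℝ} {y : E n} (h : f₁ =ᶠ[𝓝 y] f₂) (i : Fin (n + 1)) :
    pd i f₁ y = pd i f₂ y := by
  simp only [pd, h.fderiv_eq]

lemma pd_div {f₁ f₂ : E n → ℝ} {y : E n} (h₁ : DifferentiableAt ℝ f₁ y)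
    (h₂ : DifferentiableAt ℝ f₂ y) (h0 : f₂ y ≠ 0) (i : Fin (n + 1)) :
    pd i (fun z => f₁ z / f₂ z) y = (f₂ y * pd i f₁ y - f₁ y * pd i f₂ y) / f₂ y ^ 2 := by
  have h := (h₁.hasFDerivAt.mul ((hasDerivAt_inv h0).comp_hasFDerivAt y h₂.hasFDerivAt)).fderiv
  have h' : fderiv ℝ (fun z => f₁ z / f₂ z) y = _ := h
  simp only [pd, h']
  simp
  field_simp
  ring

lemma pd_sq {f : E n → ℝ} {y : E n} (h : DifferentiableAt ℝ f y) (i : Fin (n + 1)) :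
    pd i (fun z => f z ^ 2) y = 2 * f y * pd i f y := by
  have h' := (h.hasFDerivAt.pow 2).fderiv
  simp only [pd, h']
  simp

/-- The Christoffel symbols of `r⁻² h`, multiplied by `r`. They extend continuously
differentiably to the boundary `{r = 0}`. -/
noncomputable def scaledChristoffel (T : Set (E n)) (h : Fin (n + 1) → Fin (n + 1) → E n → ℝ)
    (r : E n → ℝ) (k i j : Fin (n + 1)) (y : E n) : ℝ :=
  (1 / 2) * ∑ l, (Matrix.of fun i j => h i j y)⁻¹ k l *
    (r y * (pdWithin T i (h j l) y + pdWithin T j (h i l) y - pdWithin T l (h i j) y)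
      - 2 * (pdWithin T i r y * h j l y + pdWithin T j r y * h i l y
        - pdWithin T l r y * h i j y))

lemma contDiffOn_inv_apply {T : Set (E n)} {h : Fin (n + 1) → Fin (n + 1) → E n → ℝ}
    {m : WithTop ℕ∞} (hh : ∀ i j, ContDiffOn ℝ m (h i j) T)
    (hdet : ∀ y ∈ T, (Matrix.of fun i j => h i j y).det ≠ 0) (k l : Fin (n + 1)) :
    ContDiffOn ℝ m (fun y => (Matrix.of fun i j => h i j y)⁻¹ k l) T := by
  have hd : ∀ A : E n → Matrix (Fin (n + 1)) (Fin (n + 1)) ℝ,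
      (∀ i j, ContDiffOn ℝ m (fun y => A y i j) T) → ContDiffOn ℝ m (fun y => (A y).det) T := by
    intro A hA
    simp only [Matrix.det_apply']
    exact ContDiffOn.sum fun σ _ => contDiffOn_const.mul (contDiffOn_prod fun i _ => hA _ _)
  have hadj : ContDiffOn ℝ m (fun y => (Matrix.of fun i j => h i j y).adjugate k l) T := by
    simp only [Matrix.adjugate_apply]
    refine hd _ fun i j => ?_
    simp only [Matrix.updateRow_apply]
    split_ifs
    · exact contDiffOn_const
    · exact hh i j
  have h1 : ∀ y, (Matrix.of fun i j => h i j y)⁻¹ k l =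
      (Matrix.of fun i j => h i j y).det⁻¹ * (Matrix.of fun i j => h i j y).adjugate k l := by
    intro y
    simp [Matrix.inv_def, Ring.inverse_eq_inv']
  simp only [h1]
  exact ((hd _ fun i j => hh i j).inv hdet).mul hadj

lemma contDiffOn_scaledChristoffel {T : Set (E n)} (hT : UniqueDiffOn ℝ T)
    {h : Fin (n + 1) → Fin (n + 1) → E n → ℝ} {r : E n → ℝ}
    (hh : ∀ i j, ContDiffOn ℝ 2 (h i j) T) (hr : ContDiffOn ℝ 2 r T)
    (hdet : ∀ y ∈ T, (Matrix.of fun i j => h i j y).det ≠ 0) (k i j : Fin (n + 1)) :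
    ContDiffOn ℝ 1 (scaledChristoffel T h r k i j) T := by
  have h12 : (1 : WithTop ℕ∞) ≤ 2 := by norm_num
  have h11 : (1 : WithTop ℕ∞) + 1 ≤ 2 := by norm_num
  have hp : ∀ i j l, ContDiffOn ℝ 1 (pdWithin T i (h j l)) T := fun i j l =>
    contDiffOn_pdWithin hT (hh j l) h11 i
  have hpr : ∀ i, ContDiffOn ℝ 1 (pdWithin T i r) T := fun i => contDiffOn_pdWithin hT hr h11 i
  have hr1 := hr.of_le h12
  have hh1 : ∀ i j, ContDiffOn ℝ 1 (h i j) T := fun i j => (hh i j).of_le h12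
  refine contDiffOn_const.mul (ContDiffOn.sum fun l _ => ?_)
  refine (contDiffOn_inv_apply hh1 hdet k l).mul ((hr1.mul (((hp i j l).add (hp j i l)).sub
    (hp l i j))).sub (contDiffOn_const.mul ((((hpr i).mul (hh1 j l)).add
      ((hpr j).mul (hh1 i l))).sub ((hpr l).mul (hh1 i j)))))

variable {Xbar : Type*} [TopologicalSpace Xbar]
  [ChartedSpace (EuclideanHalfSpace (n + 1)) Xbar]

lemma christoffel_eq {T O : Set (E n)} (hO : IsOpen O) (hOT : O ⊆ T)
    {h : Fin (n + 1) → Fin (n + 1) → E n → ℝ} {r : E n → ℝ}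
    (hh : ∀ i j, ContDiffOn ℝ 2 (h i j) T) (hr : ContDiffOn ℝ 2 r T)
    (hpos : ∀ y ∈ O, 0 < r y)
    {g : BilinField n Xbar} {c : Xbar}
    (hg : ∀ i j, ∀ y ∈ O, coeff g c i j y = h i j y / r y ^ 2)
    (k i j : Fin (n + 1)) {y : E n} (hy : y ∈ O) :
    christoffel g c k i j y = scaledChristoffel T h r k i j y / r y := by
  have hOy : O ∈ 𝓝 y := hO.mem_nhds hy
  have hTy : T ∈ 𝓝 y := mem_of_superset hOy hOT
  have hr0 : r y ≠ 0 := (hpos y hy).ne'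
  have hrd : DifferentiableAt ℝ r y := (hr.differentiableOn (by norm_num)).differentiableAt hTy
  have hhd : ∀ i j, DifferentiableAt ℝ (h i j) y := fun i j =>
    ((hh i j).differentiableOn (by norm_num)).differentiableAt hTy
  have hpd : ∀ m i j, pd m (coeff g c i j) y =
      pdWithin T m (h i j) y / r y ^ 2 - 2 * pdWithin T m r y * h i j y / r y ^ 3 := by
    intro m i j
    have : coeff g c i j =ᶠ[𝓝 y] fun z => h i j z / (fun z => r z ^ 2) z := by
      filter_upwards [hOy] with z hz using hg i j z hz
    have hrd2 : DifferentiableAt ℝ (fun z => r z ^ 2) y := hrd.pow 2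
    rw [pd_congr this, pd_div (hhd i j) hrd2 (pow_ne_zero 2 hr0), pd_sq hrd,
      pd_eq_pdWithin hTy, pd_eq_pdWithin hTy]
    field_simp
  have hinv : (gram g c y)⁻¹ = (r y ^ 2) • (Matrix.of fun i j => h i j y)⁻¹ := by
    have h1 : gram g c y = (r y ^ 2)⁻¹ • (Matrix.of fun i j => h i j y) := by
      ext i j
      simp only [gram, Matrix.of_apply, Matrix.smul_apply, smul_eq_mul, hg i j y hy]
      ring
    have h2 : ((r y ^ 2)⁻¹ : ℝ) = ((Units.mk0 (r y ^ 2) (pow_ne_zero 2 hr0))⁻¹ : ℝˣ) := by simp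
    by_cases hd : IsUnit (Matrix.of fun i j => h i j y).det
    · rw [h1, h2]
      rw [← Units.smul_def, Matrix.inv_smul' _ _ hd]
      simp [Units.smul_def]
    · rw [h1, Matrix.nonsing_inv_apply_not_isUnit _ hd, Matrix.nonsing_inv_apply_not_isUnit]
      · simp
      · rw [Matrix.det_smul]
        intro hcon
        exact hd (isUnit_of_mul_isUnit_right hcon)
  simp only [christoffel, scaledChristoffel, hpd, hinv, Matrix.smul_apply, smul_eq_mul]
  rw [mul_div_assoc, Finset.sum_div]
  congr 1
  refine Finset.sum_congr rfl fun l _ => ?_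
  field_simp
  ring

lemma sq_mul_riemann_eq {T O : Set (E n)} (hO : IsOpen O) (hOT : O ⊆ T) (hT : UniqueDiffOn ℝ T)
    {h : Fin (n + 1) → Fin (n + 1) → E n → ℝ} {r : E n → ℝ}
    (hh : ∀ i j, ContDiffOn ℝ 2 (h i j) T) (hr : ContDiffOn ℝ 2 r T)
    (hdet : ∀ y ∈ T, (Matrix.of fun i j => h i j y).det ≠ 0)
    (hpos : ∀ y ∈ O, 0 < r y)
    {g : BilinField n Xbar} {c : Xbar}
    (hg : ∀ i j, ∀ y ∈ O, coeff g c i j y = h i j y / r y ^ 2)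
    (l i j k : Fin (n + 1)) {y : E n} (hy : y ∈ O) :
    r y ^ 2 * riemann g c l i j k y =
      r y * pdWithin T i (scaledChristoffel T h r l j k) y
        - pdWithin T i r y * scaledChristoffel T h r l j k y
      - (r y * pdWithin T j (scaledChristoffel T h r l i k) y
        - pdWithin T j r y * scaledChristoffel T h r l i k y)
      + ∑ m, (scaledChristoffel T h r l i m y * scaledChristoffel T h r m j k y
        - scaledChristoffel T h r l j m y * scaledChristoffel T h r m i k y) := by
  have hOy : O ∈ 𝓝 y := hO.mem_nhds hy
  have hTy : T ∈ 𝓝 y := mem_of_superset hOy hOT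
  have hr0 : r y ≠ 0 := (hpos y hy).ne'
  have hrd : DifferentiableAt ℝ r y := (hr.differentiableOn (by norm_num)).differentiableAt hTy
  have hQd : ∀ k i j, DifferentiableAt ℝ (scaledChristoffel T h r k i j) y := fun k i j =>
    ((contDiffOn_scaledChristoffel hT hh hr hdet k i j).differentiableOn
      (by norm_num)).differentiableAt hTy
  have hpd : ∀ m k i j, pd m (christoffel g c k i j) y =
      (r y * pdWithin T m (scaledChristoffel T h r k i j) y
        - scaledChristoffel T h r k i j y * pdWithin T m r y) / r y ^ 2 := by
    intro m k i j
    have : christoffel g c k i j =ᶠ[𝓝 y] fun z => scaledChristoffel T h r k i j z / r z := by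
      filter_upwards [hOy] with z hz using christoffel_eq hO hOT hh hr hpos hg k i j hz
    rw [pd_congr this, pd_div (hQd k i j) hrd hr0, pd_eq_pdWithin hTy, pd_eq_pdWithin hTy]
  simp only [riemann, hpd, christoffel_eq hO hOT hh hr hpos hg _ _ _ hy, mul_add, Finset.mul_sum]
  congr 1
  · field_simp
  · refine Finset.sum_congr rfl fun m _ => ?_
    field_simp

lemma sectional_single {O : Set (E n)} {h : Fin (n + 1) → Fin (n + 1) → E n → ℝ} {r : E n → ℝ}
    (hpos : ∀ y ∈ O, 0 < r y) {g : BilinField n Xbar} {c : Xbar}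
    (hg : ∀ i j, ∀ y ∈ O, coeff g c i j y = h i j y / r y ^ 2)
    (a b : Fin (n + 1)) {y : E n} (hy : y ∈ O) :
    sectional g c y (e a) (e b) =
      (∑ l, r y ^ 2 * riemann g c l a b b y * h l a y) /
        (h a a y * h b b y - h a b y ^ 2) := by
  have hr0 : r y ≠ 0 := (hpos y hy).ne'
  have h1 : (∑ i, ∑ j, ∑ k, ∑ l, ∑ m,
      riemann g c l i j k y * (e a : E n) i * (e b : E n) j * (e b : E n) k * coeff g c l m y
        * (e a : E n) m) = ∑ l, riemann g c l a b b y * coeff g c l a y := by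
    simp [e]
  have h2 : ∀ p q : Fin (n + 1), chartInner g c y (e p) (e q) = coeff g c p q y := by
    intro p q
    simp [chartInner, e]
  rw [sectional, h1, h2, h2, h2]
  simp only [hg _ _ y hy]
  have h3 : h a a y / r y ^ 2 * (h b b y / r y ^ 2) - (h a b y / r y ^ 2) ^ 2 =
      (h a a y * h b b y - h a b y ^ 2) * ((r y ^ 2)⁻¹ * (r y ^ 2)⁻¹) := by
    field_simp
  have h4 : (∑ l, riemann g c l a b b y * (h l a y / r y ^ 2)) =
      (∑ l, r y ^ 2 * riemann g c l a b b y * h l a y) * ((r y ^ 2)⁻¹ * (r y ^ 2)⁻¹) := by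
    rw [Finset.sum_mul]
    refine Finset.sum_congr rfl fun l _ => ?_
    field_simp
  rw [h3, h4, mul_div_mul_right]
  positivity

/-- The algebraic identity behind the limit of the curvature: let
`A^k_{ij} = -(ρ_i δ^k_j + ρ_j δ^k_i - N^k H_{ij})`, the scaled Christoffel symbols where `r = 0`, and
let `N` be the vector dual to the covector `ρ`. If `ρ_b = 0`, then the curvature expression in `A`
for the plane of the coordinate vectors `a` and `b` is `-∑ ρ_k N^k` times its Gram determinant. -/
lemma curvature_limit_algebra {ι : Type*} [Fintype ι] [DecidableEq ι] (H : ι → ι → ℝ)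
    (ρ N : ι → ℝ) (hH : ∀ i j, H i j = H j i) (hN : ∀ i, ∑ m, H i m * N m = ρ i)
    (A : ι → ι → ι → ℝ)
    (hA : ∀ k i j, A k i j = -(ρ i * (if k = j then 1 else 0) + ρ j * (if k = i then 1 else 0)
      - N k * H i j))
    {a b : ι} (hb : ρ b = 0) :
    ∑ l, (-(ρ a * A l b b) - -(ρ b * A l a b) + ∑ m, (A l a m * A m b b - A l b m * A m a b))
        * H l a = -(∑ m, ρ m * N m) * (H a a * H b b - H a b ^ 2) := by
  have hN' : ∀ i, ∑ m, N m * H i m = ρ i := fun i => by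
    rw [← hN i]; exact Finset.sum_congr rfl fun _ _ => mul_comm _ _
  set S := ∑ m, ρ m * N m with hS
  have h1 : ∀ l, ∑ m, A l a m * A m b b =
      -(H b b * S * (if l = a then 1 else 0)) := by
    intro l
    have : ∀ m, A l a m * A m b b = -(ρ a * H b b) * ((if l = m then 1 else 0) * N m)
        - H b b * (if l = a then 1 else 0) * (ρ m * N m) + N l * H b b * (H a m * N m) := by
      intro m
      rw [hA, hA, hb]
      ring
    simp only [this, Finset.sum_add_distrib, Finset.sum_sub_distrib, ← Finset.mul_sum, hN, ← hS]
    simp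
    ring
  have h2 : ∀ l, ∑ m, A l b m * A m a b =
      -(N l * H b b * ρ a) - H a b * S * (if l = b then 1 else 0) := by
    intro l
    have : ∀ m, A l b m * A m a b =
        ρ a * (if l = b then 1 else 0) * ((if m = b then 1 else 0) * ρ m)
        - N l * ρ a * (H b m * (if m = b then 1 else 0))
        - H a b * (if l = b then 1 else 0) * (ρ m * N m) + N l * H a b * (H b m * N m) := by
      intro m
      rw [hA, hA, hb]
      ring
    simp only [this, Finset.sum_add_distrib, Finset.sum_sub_distrib, ← Finset.mul_sum, hN, ← hS]
    simp [hb]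
    ring
  have h3 : ∀ l, (-(ρ a * A l b b) - -(ρ b * A l a b)
      + ∑ m, (A l a m * A m b b - A l b m * A m a b)) * H l a =
      -(S * H b b) * ((if l = a then 1 else 0) * H l a)
        + S * H a b * ((if l = b then 1 else 0) * H l a) := by
    intro l
    rw [Finset.sum_sub_distrib, h1, h2, hA, hb]
    ring
  simp only [h3, Finset.sum_add_distrib, ← Finset.mul_sum]
  simp [hH b a]
  ring

/-- The sectional curvature of `r⁻² h` tends to `-|dr|²_h` at a point of `{r = 0}`. Only one
plane is considered, spanned by two coordinate vectors of which one is tangent to `{r = 0}`. -/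
lemma tendsto_sectional {T O : Set (E n)} (hO : IsOpen O) (hOT : O ⊆ T) (hT : UniqueDiffOn ℝ T)
    {h : Fin (n + 1) → Fin (n + 1) → E n → ℝ} {r : E n → ℝ}
    (hh : ∀ i j, ContDiffOn ℝ 2 (h i j) T) (hr : ContDiffOn ℝ 2 r T)
    (hdet : ∀ y ∈ T, (Matrix.of fun i j => h i j y).det ≠ 0)
    (hsymm : ∀ i j, ∀ y ∈ T, h i j y = h j i y)
    (hpos : ∀ y ∈ O, 0 < r y)
    {g : BilinField n Xbar} {c : Xbar}
    (hg : ∀ i j, ∀ y ∈ O, coeff g c i j y = h i j y / r y ^ 2)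
    {y₀ : E n} (hy₀ : y₀ ∈ T) (hr₀ : r y₀ = 0) {a b : Fin (n + 1)}
    (hb : pdWithin T b r y₀ = 0) (hab : h a a y₀ * h b b y₀ - h a b y₀ ^ 2 ≠ 0) :
    Tendsto (fun y => sectional g c y (e a) (e b)) (𝓝[O] y₀)
      (𝓝 (-∑ m, pdWithin T m r y₀ *
        ((Matrix.of fun i j => h i j y₀)⁻¹.mulVec fun i => pdWithin T i r y₀) m)) := by
  have hcont : ∀ {f : E n → ℝ}, ContinuousOn f T → Tendsto f (𝓝[O] y₀) (𝓝 (f y₀)) :=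
    fun hf => (hf y₀ hy₀).mono_left (nhdsWithin_mono _ hOT)
  have hh' : ∀ i j, ContinuousOn (h i j) T := fun i j => (hh i j).continuousOn
  have hQ1 := contDiffOn_scaledChristoffel hT hh hr hdet
  have hQ : ∀ k i j, ContinuousOn (scaledChristoffel T h r k i j) T :=
    fun k i j => (hQ1 k i j).continuousOn
  have hdQ : ∀ m k i j, ContinuousOn (pdWithin T m (scaledChristoffel T h r k i j)) T :=
    fun m k i j => (contDiffOn_pdWithin hT (m := 0) (hQ1 k i j) (by simp) m).continuousOn
  have hdr : ∀ m, ContinuousOn (pdWithin T m r) T :=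
    fun m => (contDiffOn_pdWithin hT (m := 0) hr (by norm_num) m).continuousOn
  have hrc := hr.continuousOn
  have key : ContinuousOn (fun y => (∑ l, (r y * pdWithin T a (scaledChristoffel T h r l b b) y
        - pdWithin T a r y * scaledChristoffel T h r l b b y
      - (r y * pdWithin T b (scaledChristoffel T h r l a b) y
        - pdWithin T b r y * scaledChristoffel T h r l a b y)
      + ∑ m, (scaledChristoffel T h r l a m y * scaledChristoffel T h r m b b y
        - scaledChristoffel T h r l b m y * scaledChristoffel T h r m a b y)) * h l a y)) T := by
    fun_prop
  have hden : ContinuousOn (fun y => h a a y * h b b y - h a b y ^ 2) T := by fun_prop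
  have hlim := (hcont key).div (hcont hden) hab
  set Hm : Matrix (Fin (n + 1)) (Fin (n + 1)) ℝ := Matrix.of fun i j => h i j y₀ with hHm
  set ρ : Fin (n + 1) → ℝ := fun i => pdWithin T i r y₀ with hρ
  set N : Fin (n + 1) → ℝ := Hm⁻¹.mulVec ρ with hN
  have hunit : IsUnit Hm.det := isUnit_iff_ne_zero.2 (hdet y₀ hy₀)
  have hHN : ∀ i, ∑ m, h i m y₀ * N m = ρ i := by
    intro i
    have : Hm.mulVec N = ρ := by
      rw [hN, Matrix.mulVec_mulVec, Matrix.mul_nonsing_inv _ hunit, Matrix.one_mulVec]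
    have h2 := congrFun this i
    simpa [Matrix.mulVec, dotProduct, hHm] using h2
  have hδ : ∀ k j, ∑ l, Hm⁻¹ k l * h l j y₀ = if k = j then 1 else 0 := by
    intro k j
    have := congrFun (congrFun (Matrix.nonsing_inv_mul _ hunit) k) j
    rw [Matrix.mul_apply, Matrix.one_apply] at this
    exact this
  have hA : ∀ k i j, scaledChristoffel T h r k i j y₀ =
      -(ρ i * (if k = j then 1 else 0) + ρ j * (if k = i then 1 else 0) - N k * h i j y₀) := by
    intro k i j
    have h1 : N k = ∑ l, Hm⁻¹ k l * ρ l := rfl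
    rw [← hδ, ← hδ, h1, scaledChristoffel, hr₀, Finset.mul_sum, Finset.mul_sum, Finset.mul_sum,
      Finset.sum_mul, ← Finset.sum_add_distrib, ← Finset.sum_sub_distrib, ← Finset.sum_neg_distrib]
    refine Finset.sum_congr rfl fun l _ => ?_
    rw [hsymm l j y₀ hy₀, hsymm l i y₀ hy₀]
    simp only [hρ, hHm]
    ring
  have halg := curvature_limit_algebra (fun i j => h i j y₀) ρ N (fun i j => hsymm i j y₀ hy₀) hHN
    (fun k i j => scaledChristoffel T h r k i j y₀) hA (a := a) (b := b) hb
  have heq : (∑ l, (r y₀ * pdWithin T a (scaledChristoffel T h r l b b) y₀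
        - pdWithin T a r y₀ * scaledChristoffel T h r l b b y₀
      - (r y₀ * pdWithin T b (scaledChristoffel T h r l a b) y₀
        - pdWithin T b r y₀ * scaledChristoffel T h r l a b y₀)
      + ∑ m, (scaledChristoffel T h r l a m y₀ * scaledChristoffel T h r m b b y₀
        - scaledChristoffel T h r l b m y₀ * scaledChristoffel T h r m a b y₀)) * h l a y₀)
      = -(∑ m, ρ m * N m) * (h a a y₀ * h b b y₀ - h a b y₀ ^ 2) := by
    rw [← halg]
    refine Finset.sum_congr rfl fun l _ => ?_
    rw [hr₀]
    simp only [hρ]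
    ring
  rw [heq, mul_div_assoc, div_self hab, mul_one] at hlim
  refine hlim.congr' ?_
  filter_upwards [self_mem_nhdsWithin] with y hy
  rw [sectional_single hpos hg a b hy]
  simp only [sq_mul_riemann_eq hO hOT hT hh hr hdet hpos hg _ _ _ _ hy]
  rfl

end Curvature

/-! ### The compactified metric and the defining function at a boundary point -/

section BoundaryPoint

variable {n : ℕ} {Xbar : Type*} [TopologicalSpace Xbar]
  [ChartedSpace (EuclideanHalfSpace (n + 1)) Xbar]

lemma gram_eq_of_coeff_eq {g g' : BilinField n Xbar} {c : Xbar} {y : E n} {s : ℝ}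
    (h : ∀ i j, coeff g c i j y = coeff g' c i j y / s ^ 2) :
    gram g c y = (s ^ 2)⁻¹ • gram g' c y := by
  ext i j
  simp only [gram, Matrix.of_apply, Matrix.smul_apply, smul_eq_mul, h]
  ring

lemma defining_nonneg {r : Xbar → ℝ} (hr : IsDefiningFunction n r) (x : Xbar) : 0 ≤ r x := by
  rcases (𝓡∂ (n + 1)).isInteriorPoint_or_isBoundaryPoint x with h | h
  · exact (hr.pos x h).le
  · exact (hr.zero x h).ge

lemma extChartAt_self_apply_zero {x : Xbar} (hx : x ∈ (𝓡∂ (n + 1)).boundary Xbar) :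
    extChartAt (𝓡∂ (n + 1)) x x 0 = 0 := by
  have h : extChartAt (𝓡∂ (n + 1)) x x ∈ frontier (range (𝓡∂ (n + 1))) := hx
  rw [frontier_range_modelWithCornersEuclideanHalfSpace] at h
  exact Eq.symm h

variable [IsManifold (𝓡∂ (n + 1)) ∞ Xbar]

local notation "GBar" => Bundle.ContMDiffRiemannianMetric (𝓡∂ (n + 1)) 2 (E n)
      (TangentSpace (𝓡∂ (n + 1)) : Xbar → Type _)

lemma chartInner_pos (gbar : GBar) {c : Xbar} {y : E n}
    (hy : y ∈ (extChartAt (𝓡∂ (n + 1)) c).target) {v : E n} (hv : v ≠ 0) :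
    0 < chartInner gbar.inner c y v v := by
  rw [chartInner_eq]
  refine gbar.pos _ _ fun h => hv ?_
  exact dsymm_injective hy (h.trans (map_zero _).symm)

lemma chartInner_nonneg (gbar : GBar) {c : Xbar} {y : E n}
    (hy : y ∈ (extChartAt (𝓡∂ (n + 1)) c).target) (v : E n) :
    0 ≤ chartInner gbar.inner c y v v := by
  rcases eq_or_ne v 0 with rfl | hv
  · simp [chartInner]
  · exact (chartInner_pos gbar hy hv).le

lemma coeff_symm (gbar : GBar) (c : Xbar) (i j : Fin (n + 1)) (y : E n) :
    coeff gbar.inner c i j y = coeff gbar.inner c j i y :=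
  gbar.symm _ _ _

lemma gram_posDef (gbar : GBar) {c : Xbar} {y : E n}
    (hy : y ∈ (extChartAt (𝓡∂ (n + 1)) c).target) : (gram gbar.inner c y).PosDef := by
  refine Matrix.PosDef.of_dotProduct_mulVec_pos ?_ fun v hv => ?_
  · ext i j
    simp [gram, coeff_symm gbar c i j]
  · have h := chartInner_pos gbar hy (v := WithLp.toLp 2 v) (by simpa using hv)
    refine h.trans_eq ?_
    simp only [chartInner, dotProduct, Matrix.mulVec, gram, Matrix.of_apply, Finset.mul_sum]
    refine Finset.sum_congr rfl fun i _ => Finset.sum_congr rfl fun j _ => ?_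
    simp
    ring

lemma coeff_minor_pos (gbar : GBar) {c : Xbar} {y : E n}
    (hy : y ∈ (extChartAt (𝓡∂ (n + 1)) c).target) {a b : Fin (n + 1)} (hab : a ≠ b) :
    0 < coeff gbar.inner c a a y * coeff gbar.inner c b b y - coeff gbar.inner c a b y ^ 2 := by
  have hb : (e b : E n) ≠ 0 := fun h => by simpa [e] using congrFun (congrArg WithLp.ofLp h) b
  have hv : coeff gbar.inner c b b y • (e a : E n) - coeff gbar.inner c a b y • e b ≠ 0 := by
    intro h
    have h2 := congrFun (congrArg WithLp.ofLp h) a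
    have h3 := chartInner_pos gbar hy hb
    simp [e, hab, chartInner] at h2 h3
    exact h3.ne' h2
  have h1 := chartInner_pos gbar hy hv
  have h2 := chartInner_pos gbar hy hb
  have h4 : ∀ p q : Fin (n + 1), gbar.inner ((extChartAt (𝓡∂ (n + 1)) c).symm y)
      (dsymm c y (e p)) (dsymm c y (e q)) = coeff gbar.inner c p q y := fun p q => rfl
  rw [chartInner_eq] at h1 h2
  simp only [map_sub, map_smul, sub_apply, smul_apply, smul_eq_mul, h4,
    coeff_symm gbar c b a] at h1 h2
  have h5 : 0 < coeff gbar.inner c b b y * (coeff gbar.inner c a a y * coeff gbar.inner c b b y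
      - coeff gbar.inner c a b y ^ 2) := by
    refine h1.trans_eq ?_
    ring
  exact (pos_iff_pos_of_mul_pos h5).1 h2

lemma defining_contDiffOn {r : Xbar → ℝ} (hr : IsDefiningFunction n r) (c : Xbar) :
    ContDiffOn ℝ 2 (r ∘ (extChartAt (𝓡∂ (n + 1)) c).symm)
      (extChartAt (𝓡∂ (n + 1)) c).target := by
  rw [← contMDiffOn_iff_contDiffOn]
  have hs : ContMDiffOn 𝓘(ℝ, E n) (𝓡∂ (n + 1)) 2 (extChartAt (𝓡∂ (n + 1)) c).symm
      (extChartAt (𝓡∂ (n + 1)) c).target :=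
    (contMDiffOn_extChartAt_symm (n := ∞) c).of_le (by norm_cast)
  exact hr.contMDiff.comp_contMDiffOn hs

lemma defining_pos {r : Xbar → ℝ} (hr : IsDefiningFunction n r) {c : Xbar} {y : E n}
    (hy : y ∈ (extChartAt (𝓡∂ (n + 1)) c).target) (hy0 : 0 < y 0) :
    0 < (r ∘ (extChartAt (𝓡∂ (n + 1)) c).symm) y :=
  hr.pos _ ((symm_mem_interior_iff hy).2 hy0)

/-- At a boundary point the differential of the defining function is a positive multiple of the
differential of the normal coordinate, because the function is minimal there. -/
lemma exists_fderivWithin_defining {r : Xbar → ℝ} (hr : IsDefiningFunction n r) {x : Xbar}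
    (hx : x ∈ (𝓡∂ (n + 1)).boundary Xbar) :
    ∃ b : ℝ, 0 < b ∧ ∀ v : E n,
      fderivWithin ℝ (r ∘ (extChartAt (𝓡∂ (n + 1)) x).symm) (extChartAt (𝓡∂ (n + 1)) x).target
        (extChartAt (𝓡∂ (n + 1)) x x) v = b * v 0 := by
  set y₀ := extChartAt (𝓡∂ (n + 1)) x x with hy₀
  set T := (extChartAt (𝓡∂ (n + 1)) x).target with hT
  set f := r ∘ (extChartAt (𝓡∂ (n + 1)) x).symm with hf
  have hyT : y₀ ∈ T := mem_extChartAt_target x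
  have hTn : T ∈ 𝓝[range (𝓡∂ (n + 1))] y₀ := extChartAt_target_mem_nhdsWithin x
  have hTe : 𝓝[T] y₀ = 𝓝[range (𝓡∂ (n + 1))] y₀ := nhdsWithin_extChartAt_target_eq x
  have hd : DifferentiableWithinAt ℝ f T y₀ :=
    (defining_contDiffOn hr x).differentiableOn (by norm_num) y₀ hyT
  have hfd : HasFDerivWithinAt f (fderivWithin ℝ f T y₀) (range (𝓡∂ (n + 1))) y₀ := by
    have := hd.hasFDerivWithinAt
    exact this.mono_of_mem_nhdsWithin hTn
  have hr0 : f y₀ = 0 := by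
    simp only [hf, Function.comp, hy₀, extChartAt_to_inv]
    exact hr.zero x hx
  have hmin : IsLocalMinOn f (range (𝓡∂ (n + 1))) y₀ := by
    refine Filter.Eventually.of_forall fun y => ?_
    rw [hr0]
    exact defining_nonneg hr _
  have hrange : range (𝓡∂ (n + 1)) = {y : E n | 0 ≤ y 0} :=
    range_modelWithCornersEuclideanHalfSpace (n + 1)
  have hy00 : y₀ 0 = 0 := extChartAt_self_apply_zero hx
  have hnn : ∀ v : E n, 0 ≤ v 0 → 0 ≤ fderivWithin ℝ f T y₀ v := by
    intro v hv
    refine hmin.hasFDerivWithinAt_nonneg hfd ?_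
    refine mem_posTangentConeAt_of_segment_subset ?_
    have hconv : Convex ℝ (range (𝓡∂ (n + 1))) := by
      rw [hrange]; exact EuclideanHalfSpace.convex
    refine hconv.segment_subset (extChartAt_target_subset_range x hyT) ?_
    rw [hrange]
    simp [hy00, hv]
  have hzero : ∀ v : E n, v 0 = 0 → fderivWithin ℝ f T y₀ v = 0 := by
    intro v hv
    have h1 := hnn v hv.ge
    have h2 := hnn (-v) (by simp [hv])
    rw [map_neg] at h2
    linarith
  have hform : ∀ v : E n, fderivWithin ℝ f T y₀ v = fderivWithin ℝ f T y₀ (e 0) * v 0 := by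
    intro v
    have h1 := hzero (v - v 0 • e 0) (by simp [e])
    rw [map_sub, map_smul, smul_eq_mul] at h1
    linarith
  refine ⟨_, lt_of_le_of_ne (hnn (e 0) (by simp [e])) fun h => ?_, hform⟩
  apply hr.mfderiv_ne_zero x hx
  have hmd : MDifferentiableAt (𝓡∂ (n + 1)) 𝓘(ℝ, ℝ) r x :=
    (hr.contMDiff x).mdifferentiableAt (by norm_num)
  rw [hmd.mfderiv]
  have h2 : writtenInExtChartAt (𝓡∂ (n + 1)) 𝓘(ℝ, ℝ) x r = f := rfl
  rw [h2, ← hy₀, hfd.fderivWithin ((𝓡∂ (n + 1)).uniqueDiffOn _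
    (extChartAt_target_subset_range x hyT))]
  ext v
  rw [hform, ← h, zero_mul]
  rfl

lemma coeff_eq_div {g : BilinField n Xbar} {r : Xbar → ℝ} (hr : IsDefiningFunction n r)
    {gbar : GBar} (hgr : ∀ x ∈ (𝓡∂ (n + 1)).interior Xbar,
      ∀ u v : TangentSpace (𝓡∂ (n + 1)) x, gbar.inner x u v = r x ^ 2 * g x u v)
    {c : Xbar} {y : E n} (hy : y ∈ (extChartAt (𝓡∂ (n + 1)) c).target) (hy0 : 0 < y 0)
    (i j : Fin (n + 1)) :
    coeff g c i j y =
      coeff gbar.inner c i j y / (r ∘ (extChartAt (𝓡∂ (n + 1)) c).symm) y ^ 2 := by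
  have hpos := defining_pos hr hy hy0
  rw [eq_div_iff (by positivity), mul_comm]
  exact (hgr _ ((symm_mem_interior_iff hy).2 hy0) _ _).symm

/-- At a boundary point the differential of the defining function has norm one for the
compactified metric, by the curvature condition. Hence it is bounded by that metric. -/
lemma sq_fderivWithin_defining_le (hn : 1 ≤ n) {g : BilinField n Xbar}
    (hcurv : CurvatureTendsToNegOne g) {r : Xbar → ℝ} (hr : IsDefiningFunction n r)
    {gbar : GBar} (hgr : ∀ x ∈ (𝓡∂ (n + 1)).interior Xbar,
      ∀ u v : TangentSpace (𝓡∂ (n + 1)) x, gbar.inner x u v = r x ^ 2 * g x u v)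
    {x : Xbar} (hx : x ∈ (𝓡∂ (n + 1)).boundary Xbar) {b : ℝ}
    (hb : ∀ v : E n, fderivWithin ℝ (r ∘ (extChartAt (𝓡∂ (n + 1)) x).symm)
      (extChartAt (𝓡∂ (n + 1)) x).target (extChartAt (𝓡∂ (n + 1)) x x) v = b * v 0) (v : E n) :
    (b * v 0) ^ 2 ≤ chartInner gbar.inner x (extChartAt (𝓡∂ (n + 1)) x x) v v := by
  set y₀ := extChartAt (𝓡∂ (n + 1)) x x with hy₀
  set T := (extChartAt (𝓡∂ (n + 1)) x).target with hT
  set f := r ∘ (extChartAt (𝓡∂ (n + 1)) x).symm with hf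
  set O := T ∩ {y : E n | 0 < y 0} with hO
  have hyT : y₀ ∈ T := mem_extChartAt_target x
  have hOo : IsOpen O := isOpen_target_inter x
  have hr0 : f y₀ = 0 := by
    simp only [hf, Function.comp, hy₀, extChartAt_to_inv]
    exact hr.zero x hx
  have hy00 : y₀ 0 = 0 := extChartAt_self_apply_zero hx
  let i₁ : Fin (n + 1) := ⟨1, by omega⟩
  have hi₁ : (0 : Fin (n + 1)) ≠ i₁ := by
    intro h; simpa [i₁] using congrArg Fin.val h
  have hdet : ∀ y ∈ T, (Matrix.of fun i j => coeff gbar.inner x i j y).det ≠ 0 := fun y hy =>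
    (gram_posDef gbar hy).det_pos.ne'
  have hlim := tendsto_sectional (h := fun i j => coeff gbar.inner x i j) hOo inter_subset_left
    (uniqueDiffOn_extChartAt_target x)
    (fun i j => coeff_contDiffOn gbar x i j) (defining_contDiffOn hr x) hdet
    (fun i j y _ => coeff_symm gbar x i j y) (fun y hy => defining_pos hr hy.1 hy.2)
    (g := g) (c := x) (fun i j y hy => coeff_eq_div hr hgr hy.1 hy.2 i j) hyT hr0
    (a := 0) (b := i₁) (by
      rw [pdWithin, hb]
      simp [e, i₁, Fin.ext_iff]) (coeff_minor_pos gbar hyT hi₁).ne'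
  have hne : (𝓝[O] y₀).NeBot := by
    have hP : {y : E n | 0 < y 0} ⊆ range (𝓡∂ (n + 1)) := by
      rw [range_modelWithCornersEuclideanHalfSpace]
      exact fun y (hy : 0 < y 0) => hy.le
    rw [hO, nhdsWithin_inter_of_mem
      (nhdsWithin_mono _ hP (extChartAt_target_mem_nhdsWithin x)),
      ← mem_closure_iff_nhdsWithin_neBot, closure_open_halfSpace]
    exact hy00.ge
  have hlim' : Tendsto (fun y => sectional g x y (e 0) (e i₁)) (𝓝[O] y₀) (𝓝 (-1)) := by
    rw [Metric.tendsto_nhds]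
    intro ε hε
    obtain ⟨U, hU, hbU, hUε⟩ := hcurv ε hε
    have hcont : ContinuousWithinAt (extChartAt (𝓡∂ (n + 1)) x).symm O y₀ :=
      (continuousOn_extChartAt_symm x y₀ hyT).mono inter_subset_left
    have hmem : ∀ᶠ y in 𝓝[O] y₀, (extChartAt (𝓡∂ (n + 1)) x).symm y ∈ U := by
      apply hcont
      rw [hy₀, extChartAt_to_inv]
      exact hU.mem_nhds (hbU hx)
    filter_upwards [hmem, self_mem_nhdsWithin] with y hyU hyO
    have h1 := hUε x _ hyU ((symm_mem_interior_iff hyO.1).2 hyO.2)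
      ((extChartAt (𝓡∂ (n + 1)) x).map_target hyO.1) (e 0) (e i₁) (by
        rw [LinearIndependent.pair_iff]
        intro s t hst
        have h0 := congrFun (congrArg WithLp.ofLp hst) 0
        have h1 := congrFun (congrArg WithLp.ofLp hst) i₁
        simp [e, hi₁, hi₁.symm] at h0 h1
        exact ⟨h0, h1⟩)
    rw [(extChartAt (𝓡∂ (n + 1)) x).right_inv hyO.1] at h1
    exact h1
  have huniq := tendsto_nhds_unique hlim hlim'
  set Hm : Matrix (Fin (n + 1)) (Fin (n + 1)) ℝ :=
    Matrix.of fun i j => coeff gbar.inner x i j y₀ with hHm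
  set ρ : Fin (n + 1) → ℝ := fun i => pdWithin T i f y₀ with hρ
  set N : Fin (n + 1) → ℝ := Hm⁻¹.mulVec ρ with hN
  have hunit : IsUnit Hm.det := isUnit_iff_ne_zero.2 (hdet y₀ hyT)
  have hHN : ∀ i, ∑ m, coeff gbar.inner x i m y₀ * N m = ρ i := by
    intro i
    have : Hm.mulVec N = ρ := by
      rw [hN, Matrix.mulVec_mulVec, Matrix.mul_nonsing_inv _ hunit, Matrix.one_mulVec]
    exact congrFun this i
  have hρN : ∑ m, ρ m * N m = 1 := neg_injective huniq
  have hinner : ∀ u : E n, chartInner gbar.inner x y₀ u (WithLp.toLp 2 N) = b * u 0 := by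
    intro u
    have h1 : ∀ i, ∑ j, coeff gbar.inner x i j y₀ * u i * N j = u i * ρ i := by
      intro i
      rw [← hHN, Finset.mul_sum]
      exact Finset.sum_congr rfl fun j _ => by ring
    simp only [chartInner, h1]
    rw [← hb u]
    conv_rhs => rw [← sum_smul_e u]
    simp only [map_sum, map_smul, smul_eq_mul, hρ, pdWithin]
  have hbN : b * N 0 = 1 := by
    rw [← hρN]
    simp only [hρ, pdWithin, hb]
    simp [e]
  -- Cauchy-Schwarz for `v` and the unit vector `N` dual to the differential of `f`.
  have hfin := chartInner_nonneg gbar hyT (v - (b * v 0) • WithLp.toLp 2 N)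
  have h1 := hinner v
  have h2 := hinner (WithLp.toLp 2 N)
  have hsy : chartInner gbar.inner x y₀ (WithLp.toLp 2 N) v = b * v 0 := by
    rw [← h1, chartInner_eq, chartInner_eq, gbar.symm]
  rw [chartInner_eq] at hfin h1 h2 hsy ⊢
  simp only [map_sub, map_smul, sub_apply, smul_apply, smul_eq_mul] at hfin
  rw [h1, h2, hsy] at hfin
  simp only [hbN] at hfin
  nlinarith

end BoundaryPoint

/-! ### The Riemannian volume in a chart -/

lemma measurableSet_inter_preimage {α β : Type*} [TopologicalSpace α] [MeasurableSpace α]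
    [BorelSpace α] [TopologicalSpace β] [MeasurableSpace β] [BorelSpace β] {f : α → β} {T : Set α}
    (hf : ContinuousOn f T) (hT : MeasurableSet T) {A : Set β} (hA : MeasurableSet A) :
    MeasurableSet (T ∩ f ⁻¹' A) := by
  have h : Measurable (T.domRestrict f) := (continuousOn_iff_continuous_domRestrict.1 hf).measurable
  have h1 := hT.subtype_image (h hA)
  have h2 : Subtype.val '' (T.domRestrict f ⁻¹' A) = T ∩ f ⁻¹' A := by
    ext x
    simp [Set.domRestrict, and_comm]
  rwa [h2] at h1

section Volume

variable {n : ℕ} {Xbar : Type*} [TopologicalSpace Xbar]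
  [ChartedSpace (EuclideanHalfSpace (n + 1)) Xbar]

/-- The density `√det(g_{ij})` of the Riemannian volume in the chart about `c`. -/
noncomputable def volDensity (g : BilinField n Xbar) (c : Xbar) (y : E n) : ℝ≥0∞ :=
  ENNReal.ofReal (Real.sqrt (gram g c y).det)

/-- The Riemannian volume of the part of the space covered by the chart about `c`. -/
noncomputable def chartVol [MeasurableSpace Xbar] (g : BilinField n Xbar) (c : Xbar) :
    Measure Xbar :=
  Measure.map (extChartAt (𝓡∂ (n + 1)) c).symm
    (((volume : Measure (E n)).restrict (extChartAt (𝓡∂ (n + 1)) c).target).withDensity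
      (volDensity g c))

lemma measurableSet_target (c : Xbar) :
    MeasurableSet (extChartAt (𝓡∂ (n + 1)) c).target := by
  rw [extChartAt_target]
  refine MeasurableSet.inter ?_ ?_
  · exact ((chartAt (EuclideanHalfSpace (n + 1)) c).open_target.preimage
      (𝓡∂ (n + 1)).continuous_symm).measurableSet
  · exact (𝓡∂ (n + 1)).isClosed_range.measurableSet

lemma chartVol_apply [MeasurableSpace Xbar] [BorelSpace Xbar] (g : BilinField n Xbar) (c : Xbar)
    {A : Set Xbar} (hA : MeasurableSet A) :
    chartVol g c A = ∫⁻ y in (extChartAt (𝓡∂ (n + 1)) c).target ∩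
      (extChartAt (𝓡∂ (n + 1)) c).symm ⁻¹' A, volDensity g c y := by
  have hm : AEMeasurable (extChartAt (𝓡∂ (n + 1)) c).symm
      (((volume : Measure (E n)).restrict (extChartAt (𝓡∂ (n + 1)) c).target).withDensity
      (volDensity g c)) :=
    ((continuousOn_extChartAt_symm c).aemeasurable (measurableSet_target c)).mono_ac
      (withDensity_absolutelyContinuous _ _)
  rw [chartVol, Measure.map_apply_of_aemeasurable hm hA, withDensity_apply',
    Measure.restrict_restrict' (measurableSet_target c), inter_comm]

variable [IsManifold (𝓡∂ (n + 1)) ∞ Xbar]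

/-- The derivative of the chart about `c` at `x`. -/
noncomputable def dchart (c x : Xbar) : TangentSpace (𝓡∂ (n + 1)) x →L[ℝ] E n :=
  mfderiv (𝓡∂ (n + 1)) 𝓘(ℝ, E n) (extChartAt (𝓡∂ (n + 1)) c) x

lemma dsymm_dchart {c : Xbar} {y : E n} (hy : y ∈ (extChartAt (𝓡∂ (n + 1)) c).target)
    (w : TangentSpace (𝓡∂ (n + 1)) ((extChartAt (𝓡∂ (n + 1)) c).symm y)) :
    dsymm c y (dchart c ((extChartAt (𝓡∂ (n + 1)) c).symm y) w) = w :=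
  DFunLike.congr_fun
    (mfderivWithin_extChartAt_symm_comp_mfderiv_extChartAt (I := 𝓡∂ (n + 1)) hy) w

lemma inner_eq_chartInner (g : BilinField n Xbar) {c x : Xbar}
    (hx : x ∈ (extChartAt (𝓡∂ (n + 1)) c).source) (u v : TangentSpace (𝓡∂ (n + 1)) x) :
    g x u v = chartInner g c (extChartAt (𝓡∂ (n + 1)) c x) (dchart c x u) (dchart c x v) := by
  obtain ⟨y, hy, rfl⟩ : ∃ y ∈ (extChartAt (𝓡∂ (n + 1)) c).target,
      (extChartAt (𝓡∂ (n + 1)) c).symm y = x :=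
    ⟨_, (extChartAt (𝓡∂ (n + 1)) c).map_source hx, (extChartAt (𝓡∂ (n + 1)) c).left_inv hx⟩
  rw [(extChartAt (𝓡∂ (n + 1)) c).right_inv hy, chartInner_eq, dsymm_dchart hy, dsymm_dchart hy]

/-- The derivative of the change of coordinates from the chart about `c'` to that about `c`. -/
noncomputable def transition (c' c : Xbar) (y : E n) : E n →L[ℝ] E n :=
  (dchart c ((extChartAt (𝓡∂ (n + 1)) c').symm y)).comp (dsymm c' y)

lemma hasFDerivAt_transition {c' c : Xbar} {y : E n}
    (hy : y ∈ (extChartAt (𝓡∂ (n + 1)) c').target) (hy0 : 0 < y 0)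
    (hyc : (extChartAt (𝓡∂ (n + 1)) c').symm y ∈ (extChartAt (𝓡∂ (n + 1)) c).source) :
    HasFDerivAt (extChartAt (𝓡∂ (n + 1)) c ∘ (extChartAt (𝓡∂ (n + 1)) c').symm)
      (transition c' c y) y := by
  have h1 := (mdifferentiableWithinAt_extChartAt_symm (I := 𝓡∂ (n + 1)) hy).hasMFDerivWithinAt
  have hr : range (𝓡∂ (n + 1)) ∈ 𝓝 y := by
    rw [← mem_interior_iff_mem_nhds, interior_range_modelWithCornersEuclideanHalfSpace]
    exact hy0
  have h2 := h1.hasMFDerivAt hr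
  have h3 := (mdifferentiableAt_extChartAt (I := 𝓡∂ (n + 1))
    (by simpa using hyc : _ ∈ (chartAt (EuclideanHalfSpace (n + 1)) c).source)).hasMFDerivAt
  exact (h3.comp y h2).hasFDerivAt

lemma det_gram_eq (g : BilinField n Xbar) {c' c : Xbar} {y : E n}
    (hyc : (extChartAt (𝓡∂ (n + 1)) c').symm y ∈ (extChartAt (𝓡∂ (n + 1)) c).source) :
    (gram g c' y).det = (transition c' c y).det ^ 2 *
      (gram g c (extChartAt (𝓡∂ (n + 1)) c ((extChartAt (𝓡∂ (n + 1)) c').symm y))).det := by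
  set M := LinearMap.toMatrix (EuclideanSpace.basisFun (Fin (n + 1)) ℝ).toBasis
    (EuclideanSpace.basisFun (Fin (n + 1)) ℝ).toBasis (transition c' c y : E n →ₗ[ℝ] E n) with hM
  have hMe : ∀ i j, M i j = transition c' c y (e j) i := by
    intro i j
    simp [hM, LinearMap.toMatrix_apply, e]
  have hdet : M.det = (transition c' c y).det := by
    rw [hM, LinearMap.det_toMatrix]
  have h : gram g c' y = M.transpose *
      gram g c (extChartAt (𝓡∂ (n + 1)) c ((extChartAt (𝓡∂ (n + 1)) c').symm y)) * M := by
    ext i j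
    have h1 : gram g c' y i j = chartInner g c
        (extChartAt (𝓡∂ (n + 1)) c ((extChartAt (𝓡∂ (n + 1)) c').symm y))
        (transition c' c y (e i)) (transition c' c y (e j)) :=
      inner_eq_chartInner g hyc _ _
    rw [h1]
    simp only [chartInner, Matrix.mul_apply, Matrix.transpose_apply, hMe, Finset.sum_mul, gram,
      Matrix.of_apply]
    rw [Finset.sum_comm]
    refine Finset.sum_congr rfl fun a _ => Finset.sum_congr rfl fun b _ => by ring
  rw [h, Matrix.det_mul, Matrix.det_mul, Matrix.det_transpose, hdet]
  ring

lemma volDensity_transition (g : BilinField n Xbar) {c' c : Xbar} {y : E n}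
    (hyc : (extChartAt (𝓡∂ (n + 1)) c').symm y ∈ (extChartAt (𝓡∂ (n + 1)) c).source) :
    volDensity g c' y = ENNReal.ofReal |(transition c' c y).det| *
      volDensity g c (extChartAt (𝓡∂ (n + 1)) c ((extChartAt (𝓡∂ (n + 1)) c').symm y)) := by
  rw [volDensity, volDensity, det_gram_eq g hyc, Real.sqrt_mul (sq_nonneg _),
    Real.sqrt_sq_eq_abs, ENNReal.ofReal_mul (abs_nonneg _)]

variable [MeasurableSpace Xbar] [BorelSpace Xbar]

/-- On the interior part of the chart about `c`, the volume computed in another chart does not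
exceed the volume computed in the chart about `c`. -/
lemma chartVol_le (g : BilinField n Xbar) (c' c : Xbar) {A : Set Xbar} (hA : MeasurableSet A)
    (hAS : A ⊆ (extChartAt (𝓡∂ (n + 1)) c).source ∩ (𝓡∂ (n + 1)).interior Xbar) :
    chartVol g c' A ≤ chartVol g c A := by
  rw [chartVol_apply g c' hA, chartVol_apply g c hA]
  set B := (extChartAt (𝓡∂ (n + 1)) c').target ∩ (extChartAt (𝓡∂ (n + 1)) c').symm ⁻¹' A with hB
  have hBm : MeasurableSet B :=
    measurableSet_inter_preimage (continuousOn_extChartAt_symm c') (measurableSet_target c') hA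
  have hinj : InjOn (extChartAt (𝓡∂ (n + 1)) c ∘ (extChartAt (𝓡∂ (n + 1)) c').symm) B := by
    intro y hy z hz hyz
    have h1 := (extChartAt (𝓡∂ (n + 1)) c).injOn (hAS hy.2).1 (hAS hz.2).1 hyz
    exact (extChartAt (𝓡∂ (n + 1)) c').symm.injOn hy.1 hz.1 h1
  calc ∫⁻ y in B, volDensity g c' y
      = ∫⁻ y in B, ENNReal.ofReal |(transition c' c y).det| *
          volDensity g c (extChartAt (𝓡∂ (n + 1)) c ((extChartAt (𝓡∂ (n + 1)) c').symm y)) :=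
        setLIntegral_congr_fun hBm fun y hy => volDensity_transition g (hAS hy.2).1
    _ = ∫⁻ z in (extChartAt (𝓡∂ (n + 1)) c ∘ (extChartAt (𝓡∂ (n + 1)) c').symm) '' B,
          volDensity g c z :=
        (lintegral_image_eq_lintegral_abs_det_fderiv_mul volume hBm
          (fun y hy => (hasFDerivAt_transition hy.1
            ((symm_mem_interior_iff hy.1).1 (hAS hy.2).2) (hAS hy.2).1).hasFDerivWithinAt)
          hinj _).symm
    _ ≤ _ := by
        refine lintegral_mono_set ?_
        rintro _ ⟨y, hy, rfl⟩
        refine ⟨(extChartAt (𝓡∂ (n + 1)) c).map_source (hAS hy.2).1, ?_⟩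
        simp only [Function.comp, mem_preimage, (extChartAt (𝓡∂ (n + 1)) c).left_inv (hAS hy.2).1]
        exact hy.2

lemma vol_apply (g : BilinField n Xbar) (c : Xbar) {A : Set Xbar} (hA : MeasurableSet A)
    (hAS : A ⊆ (extChartAt (𝓡∂ (n + 1)) c).source ∩ (𝓡∂ (n + 1)).interior Xbar) :
    vol g A = chartVol g c A := by
  have hle : ∀ c, chartVol g c ≤ vol g := fun c => le_iSup (fun c => chartVol g c) c
  refine le_antisymm ?_ (hle c A)
  -- The measure `ν` equals the volume in the chart on `A` and is infinite off `A`.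
  set ν : Measure Xbar := (chartVol g c).restrict A + (⊤ : Measure Xbar).restrict Aᶜ with hν
  have hν' : vol g ≤ ν := by
    refine iSup_le fun c' => ?_
    change chartVol g c' ≤ ν
    rw [← Measure.restrict_add_restrict_compl (μ := chartVol g c') hA]
    refine add_le_add ?_ (Measure.restrict_mono_measure le_top _)
    refine Measure.le_iff.2 fun D hD => ?_
    rw [Measure.restrict_apply hD, Measure.restrict_apply hD]
    exact chartVol_le g c' c (hD.inter hA) (inter_subset_right.trans hAS)
  refine (hν' A).trans ?_
  rw [hν, Measure.add_apply, Measure.restrict_apply hA, Measure.restrict_apply hA]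
  simp

/-- The Riemannian volume in the coordinates given by a parametrization `Φ` of a part of the
domain of the chart about `c`. -/
lemma vol_restrict_image (g : BilinField n Xbar) (c : Xbar) {Φ : E n → E n}
    {Φ' : E n → E n →L[ℝ] E n} {B : Set (E n)} (hB : MeasurableSet B)
    (hΦ : ∀ w ∈ B, HasFDerivAt Φ (Φ' w) w) (hinj : InjOn Φ B)
    (hmaps : ∀ w ∈ B, Φ w ∈ (extChartAt (𝓡∂ (n + 1)) c).target ∧ 0 < Φ w 0)
    (hW : MeasurableSet ((extChartAt (𝓡∂ (n + 1)) c).symm ∘ Φ '' B)) :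
    (vol g).restrict ((extChartAt (𝓡∂ (n + 1)) c).symm ∘ Φ '' B) =
      Measure.map ((extChartAt (𝓡∂ (n + 1)) c).symm ∘ Φ)
        ((volume.restrict B).withDensity
          fun w => ENNReal.ofReal |(Φ' w).det| * volDensity g c (Φ w)) := by
  have hcont : ContinuousOn ((extChartAt (𝓡∂ (n + 1)) c).symm ∘ Φ) B :=
    (continuousOn_extChartAt_symm c).comp
      (fun w hw => (hΦ w hw).continuousAt.continuousWithinAt) fun w hw => (hmaps w hw).1
  have hWS : ((extChartAt (𝓡∂ (n + 1)) c).symm ∘ Φ '' B) ⊆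
      (extChartAt (𝓡∂ (n + 1)) c).source ∩ (𝓡∂ (n + 1)).interior Xbar := by
    rintro _ ⟨w, hw, rfl⟩
    exact ⟨(extChartAt (𝓡∂ (n + 1)) c).map_target (hmaps w hw).1,
      (symm_mem_interior_iff (hmaps w hw).1).2 (hmaps w hw).2⟩
  ext A hA
  have hm : AEMeasurable ((extChartAt (𝓡∂ (n + 1)) c).symm ∘ Φ)
      ((volume.restrict B).withDensity
          fun w => ENNReal.ofReal |(Φ' w).det| * volDensity g c (Φ w)) :=
    (hcont.aemeasurable hB).mono_ac (withDensity_absolutelyContinuous _ _)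
  have hBA : MeasurableSet (B ∩ ((extChartAt (𝓡∂ (n + 1)) c).symm ∘ Φ) ⁻¹' A) :=
    measurableSet_inter_preimage hcont hB hA
  have hset : (extChartAt (𝓡∂ (n + 1)) c).target ∩ (extChartAt (𝓡∂ (n + 1)) c).symm ⁻¹'
      (A ∩ ((extChartAt (𝓡∂ (n + 1)) c).symm ∘ Φ '' B)) =
      Φ '' (B ∩ ((extChartAt (𝓡∂ (n + 1)) c).symm ∘ Φ) ⁻¹' A) := by
    ext y
    constructor
    · rintro ⟨hy, hyA, w, hw, hwy⟩
      have : Φ w = y := (extChartAt (𝓡∂ (n + 1)) c).symm.injOn (hmaps w hw).1 hy hwy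
      subst this
      exact ⟨w, ⟨hw, hyA⟩, rfl⟩
    · rintro ⟨w, ⟨hw, hwA⟩, rfl⟩
      exact ⟨(hmaps w hw).1, hwA, w, hw, rfl⟩
  rw [Measure.restrict_apply hA, vol_apply g c (hA.inter hW) (inter_subset_right.trans hWS),
    chartVol_apply g c (hA.inter hW), hset,
    lintegral_image_eq_lintegral_abs_det_fderiv_mul volume hBA
      (fun w hw => (hΦ w hw.1).hasFDerivWithinAt) (hinj.mono inter_subset_left),
    Measure.map_apply_of_aemeasurable hm hA, withDensity_apply',
    Measure.restrict_restrict' hB, inter_comm]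

end Volume

/-! ### Domains and test functions transported from Euclidean space -/

/-- A diffeomorphism of the Euclidean space onto the open half-space `{y | 0 < y 0}`. -/
structure HalfSpaceDiffeo (n : ℕ) where
  /-- The diffeomorphism. -/
  toFun : E n → E n
  /-- Its inverse, with arbitrary values outside the open half-space. -/
  inv : E n → E n
  contDiff : ContDiff ℝ ∞ toFun
  contDiffOn_inv : ContDiffOn ℝ ∞ inv {y | 0 < y 0}
  pos : ∀ w, 0 < toFun w 0
  left_inv : ∀ w, inv (toFun w) = w
  right_inv : ∀ y, 0 < y 0 → toFun (inv y) = y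

section Transport

variable {n : ℕ}

lemma isOpen_halfSpace : IsOpen {y : E n | 0 < y 0} :=
  isOpen_lt continuous_const (by fun_prop)

namespace HalfSpaceDiffeo

variable (Φ : HalfSpaceDiffeo n)

lemma hasFDerivAt (w : E n) : HasFDerivAt Φ.toFun (fderiv ℝ Φ.toFun w) w :=
  (Φ.contDiff.differentiable (by simp) w).hasFDerivAt

lemma hasFDerivAt_inv {y : E n} (hy : 0 < y 0) : HasFDerivAt Φ.inv (fderiv ℝ Φ.inv y) y :=
  ((Φ.contDiffOn_inv.differentiableOn (by simp)).differentiableAt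
    (isOpen_halfSpace.mem_nhds hy)).hasFDerivAt

lemma injective : Function.Injective Φ.toFun := Function.LeftInverse.injective Φ.left_inv

lemma fderiv_fderiv_inv (w η : E n) :
    fderiv ℝ Φ.toFun w (fderiv ℝ Φ.inv (Φ.toFun w) η) = η := by
  have h1 := Φ.hasFDerivAt_inv (Φ.pos w)
  have h2 : HasFDerivAt Φ.toFun (fderiv ℝ Φ.toFun w) (Φ.inv (Φ.toFun w)) := by
    rw [Φ.left_inv]; exact Φ.hasFDerivAt w
  have h3 := h2.comp (Φ.toFun w) h1
  have h4 : Φ.toFun ∘ Φ.inv =ᶠ[𝓝 (Φ.toFun w)] id := by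
    filter_upwards [isOpen_halfSpace.mem_nhds (Φ.pos w)] with y hy using Φ.right_inv y hy
  exact DFunLike.congr_fun (h3.unique ((hasFDerivAt_id _).congr_of_eventuallyEq h4)) η

variable {Xbar : Type*} [TopologicalSpace Xbar] [ChartedSpace (EuclideanHalfSpace (n + 1)) Xbar]

/-- The map from Euclidean space to the manifold obtained from the chart about `c`; it is
meaningful at the points which `Φ` maps into the target of the chart. -/
noncomputable def lift (c : Xbar) (w : E n) : Xbar := (extChartAt (𝓡∂ (n + 1)) c).symm (Φ.toFun w)

/-- The inverse of `Φ.lift c`. -/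
noncomputable def coord (c : Xbar) (x : Xbar) : E n := Φ.inv (extChartAt (𝓡∂ (n + 1)) c x)

/-- The interior part of the domain of the chart about `c`. -/
def interiorSource (n : ℕ) {Xbar : Type*} [TopologicalSpace Xbar]
    [ChartedSpace (EuclideanHalfSpace (n + 1)) Xbar] (c : Xbar) : Set Xbar :=
  (extChartAt (𝓡∂ (n + 1)) c).source ∩ extChartAt (𝓡∂ (n + 1)) c ⁻¹' {y : E n | 0 < y 0}

lemma isOpen_interiorSource (c : Xbar) : IsOpen (interiorSource n c) :=
  (continuousOn_extChartAt c).isOpen_inter_preimage (isOpen_extChartAt_source c) isOpen_halfSpace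

lemma lift_mem {c : Xbar} {w : E n} (hw : Φ.toFun w ∈ (extChartAt (𝓡∂ (n + 1)) c).target) :
    Φ.lift c w ∈ interiorSource n c := by
  refine ⟨(extChartAt (𝓡∂ (n + 1)) c).map_target hw, ?_⟩
  rw [mem_preimage, lift, (extChartAt (𝓡∂ (n + 1)) c).right_inv hw]
  exact Φ.pos w

lemma coord_lift {c : Xbar} {w : E n}
    (hw : Φ.toFun w ∈ (extChartAt (𝓡∂ (n + 1)) c).target) : Φ.coord c (Φ.lift c w) = w := by
  rw [coord, lift, (extChartAt (𝓡∂ (n + 1)) c).right_inv hw, Φ.left_inv]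

lemma lift_coord {c x : Xbar} (hx : x ∈ interiorSource n c) : Φ.lift c (Φ.coord c x) = x := by
  rw [coord, lift, Φ.right_inv _ hx.2, (extChartAt (𝓡∂ (n + 1)) c).left_inv hx.1]

variable {c : Xbar}

lemma continuousOn_lift {s : Set (E n)}
    (hs : ∀ w ∈ s, Φ.toFun w ∈ (extChartAt (𝓡∂ (n + 1)) c).target) :
    ContinuousOn (Φ.lift c) s :=
  (continuousOn_extChartAt_symm c).comp Φ.contDiff.continuous.continuousOn hs

lemma lift_image_eq {s : Set (E n)}
    (hs : ∀ w ∈ s, Φ.toFun w ∈ (extChartAt (𝓡∂ (n + 1)) c).target) :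
    Φ.lift c '' s = interiorSource n c ∩ Φ.coord c ⁻¹' s := by
  ext x
  constructor
  · rintro ⟨w, hw, rfl⟩
    refine ⟨Φ.lift_mem (hs w hw), ?_⟩
    rwa [mem_preimage, Φ.coord_lift (hs w hw)]
  · rintro ⟨hx, hxs⟩
    exact ⟨_, hxs, Φ.lift_coord hx⟩

lemma isCompact_lift_image {ρ : ℝ}
    (hs : ∀ w ∈ Metric.closedBall (0 : E n) ρ, Φ.toFun w ∈ (extChartAt (𝓡∂ (n + 1)) c).target) :
    IsCompact (Φ.lift c '' Metric.closedBall 0 ρ) :=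
  (isCompact_closedBall _ _).image_of_continuousOn (Φ.continuousOn_lift hs)

open Classical in
/-- The function on the manifold that has the coordinate expression `f`, extended by zero. -/
noncomputable def extend (c : Xbar) (f : E n → ℝ) (x : Xbar) : ℝ :=
  if x ∈ interiorSource n c then f (Φ.coord c x) else 0

lemma extend_lift {f : E n → ℝ} {w : E n}
    (hw : Φ.toFun w ∈ (extChartAt (𝓡∂ (n + 1)) c).target) :
    Φ.extend c f (Φ.lift c w) = f w := by
  rw [extend, if_pos (Φ.lift_mem hw), Φ.coord_lift hw]

lemma extend_eventuallyEq {f : E n → ℝ} {x : Xbar} (hx : x ∈ interiorSource n c) :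
    Φ.extend c f =ᶠ[𝓝 x] f ∘ Φ.coord c := by
  filter_upwards [(isOpen_interiorSource c).mem_nhds hx] with y hy
  rw [extend, if_pos hy, Function.comp]

variable [IsManifold (𝓡∂ (n + 1)) ∞ Xbar]

lemma contMDiffOn_coord :
    ContMDiffOn (𝓡∂ (n + 1)) 𝓘(ℝ, E n) ∞ (Φ.coord c) (interiorSource n c) := by
  have h1 : ContMDiffOn (𝓡∂ (n + 1)) 𝓘(ℝ, E n) ∞ (extChartAt (𝓡∂ (n + 1)) c)
      (interiorSource n c) :=
    (contMDiffOn_extChartAt (I := 𝓡∂ (n + 1)) (x := c)).mono fun x hx => by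
      simpa using hx.1
  exact (Φ.contDiffOn_inv.contMDiffOn).comp h1 fun x hx => hx.2

lemma interiorSource_subset : interiorSource n c ⊆ (𝓡∂ (n + 1)).interior Xbar := fun _ hx =>
  (mem_interior_iff_of_mem_source hx.1).2 hx.2

lemma mdifferentiableAt_lift {w : E n}
    (hw : Φ.toFun w ∈ (extChartAt (𝓡∂ (n + 1)) c).target) :
    MDifferentiableAt 𝓘(ℝ, E n) (𝓡∂ (n + 1)) (Φ.lift c) w := by
  have hr : range (𝓡∂ (n + 1)) ∈ 𝓝 (Φ.toFun w) := by
    rw [← mem_interior_iff_mem_nhds, interior_range_modelWithCornersEuclideanHalfSpace]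
    exact Φ.pos w
  have h1 := (mdifferentiableWithinAt_extChartAt_symm (I := 𝓡∂ (n + 1)) hw).mdifferentiableAt hr
  have h2 : MDifferentiableAt 𝓘(ℝ, E n) 𝓘(ℝ, E n) Φ.toFun w :=
    (Φ.contDiff.differentiable (by simp) w).mdifferentiableAt
  exact h1.comp w h2

lemma diff_extend_apply {f : E n → ℝ} (hf : ContDiff ℝ ∞ f) {w : E n}
    (hw : Φ.toFun w ∈ (extChartAt (𝓡∂ (n + 1)) c).target)
    (v : TangentSpace (𝓡∂ (n + 1)) (Φ.lift c w)) :
    diff (Φ.extend c f) (Φ.lift c w) v =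
      fderiv ℝ f w (fderiv ℝ Φ.inv (Φ.toFun w) (dchart c (Φ.lift c w) v)) := by
  have hxN := Φ.lift_mem hw
  have hx : extChartAt (𝓡∂ (n + 1)) c (Φ.lift c w) = Φ.toFun w :=
    (extChartAt (𝓡∂ (n + 1)) c).right_inv hw
  have h1 := (mdifferentiableAt_extChartAt (I := 𝓡∂ (n + 1))
    (by simpa using hxN.1 :
      Φ.lift c w ∈ (chartAt (EuclideanHalfSpace (n + 1)) c).source)).hasMFDerivAt
  have h2 : HasFDerivAt (f ∘ Φ.inv) ((fderiv ℝ f w).comp (fderiv ℝ Φ.inv (Φ.toFun w)))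
      (extChartAt (𝓡∂ (n + 1)) c (Φ.lift c w)) := by
    rw [hx]
    refine HasFDerivAt.comp _ ?_ (Φ.hasFDerivAt_inv (Φ.pos w))
    rw [Φ.left_inv]
    exact (hf.differentiable (by simp) w).hasFDerivAt
  have h3 := (h2.hasMFDerivAt.comp _ h1).congr_of_eventuallyEq (Φ.extend_eventuallyEq hxN)
  exact DFunLike.congr_fun h3.mfderiv v

lemma covNorm_diff_extend_le (g : BilinField n Xbar) {f : E n → ℝ} (hf : ContDiff ℝ ∞ f) {w : E n}
    (hw : Φ.toFun w ∈ (extChartAt (𝓡∂ (n + 1)) c).target) {m : ℝ}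
    (hm : ∀ ξ : E n, chartInner g c (Φ.toFun w) (fderiv ℝ Φ.toFun w ξ) (fderiv ℝ Φ.toFun w ξ) ≤ 1 →
      |fderiv ℝ f w ξ| ≤ m) :
    covNorm g (Φ.lift c w) (diff (Φ.extend c f) (Φ.lift c w)) ≤ ENNReal.ofReal m := by
  refine iSup_le fun ⟨v, hv⟩ => ENNReal.ofReal_le_ofReal ?_
  rw [Φ.diff_extend_apply hf hw]
  refine hm _ ?_
  rw [inner_eq_chartInner g (Φ.lift_mem hw).1] at hv
  rw [Φ.fderiv_fderiv_inv]
  have hx : extChartAt (𝓡∂ (n + 1)) c (Φ.lift c w) = Φ.toFun w :=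
    (extChartAt (𝓡∂ (n + 1)) c).right_inv hw
  rwa [hx] at hv

variable [T2Space Xbar]

/-- The image of a ball is a bounded domain with smooth boundary: `|coord|² - ρ²` is a defining
function of its boundary. -/
lemma isSmoothBoundedDomain_lift {ρ : ℝ} (hρ : 0 < ρ)
    (hs : ∀ w ∈ Metric.closedBall (0 : E n) ρ, Φ.toFun w ∈ (extChartAt (𝓡∂ (n + 1)) c).target) :
    IsSmoothBoundedDomain n (Φ.lift c '' Metric.ball 0 ρ) := by
  have hs' : ∀ w ∈ Metric.ball (0 : E n) ρ, Φ.toFun w ∈ (extChartAt (𝓡∂ (n + 1)) c).target :=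
    fun w hw => hs w (Metric.ball_subset_closedBall hw)
  have hopen : IsOpen (Φ.lift c '' Metric.ball 0 ρ) := by
    rw [Φ.lift_image_eq hs']
    exact (Φ.contMDiffOn_coord.continuousOn).isOpen_inter_preimage (isOpen_interiorSource c)
      Metric.isOpen_ball
  have hK := Φ.isCompact_lift_image hs
  have hcl : closure (Φ.lift c '' Metric.ball 0 ρ) ⊆ Φ.lift c '' Metric.closedBall 0 ρ :=
    closure_minimal (image_mono Metric.ball_subset_closedBall) hK.isClosed
  refine ⟨hopen, ?_, hK.of_isClosed_subset isClosed_closure hcl, ?_, ?_⟩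
  · exact ((convex_ball (0 : E n) ρ).isConnected ⟨0, Metric.mem_ball_self hρ⟩).image _
      (Φ.continuousOn_lift hs')
  · refine hcl.trans ?_
    rintro _ ⟨w, hw, rfl⟩
    exact interiorSource_subset (Φ.lift_mem (hs w hw))
  · intro x hx
    rw [hopen.frontier_eq] at hx
    obtain ⟨w, hw, rfl⟩ := hcl hx.1
    have hwT := hs w hw
    have hxN := Φ.lift_mem hwT
    have hwρ : ‖w‖ = ρ := by
      refine le_antisymm (by simpa using hw) (not_lt.1 fun h => hx.2 ⟨w, by simpa using h, rfl⟩)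
    set F : Xbar → ℝ := fun x => ‖Φ.coord c x‖ ^ 2 - ρ ^ 2 with hF
    have hq : ContDiff ℝ ∞ fun w : E n => ‖w‖ ^ 2 - ρ ^ 2 :=
      (contDiff_norm_sq ℝ).sub contDiff_const
    have hFs : ContMDiffOn (𝓡∂ (n + 1)) 𝓘(ℝ, ℝ) ∞ F (interiorSource n c) :=
      hq.contMDiff.comp_contMDiffOn Φ.contMDiffOn_coord
    refine ⟨interiorSource n c, F, isOpen_interiorSource c, hxN, hFs, ?_, ?_, ?_⟩
    · simp [hF, Φ.coord_lift hwT, hwρ]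
    · intro hzero
      have hd1 : MDifferentiableAt (𝓡∂ (n + 1)) 𝓘(ℝ, ℝ) F (Φ.lift c w) :=
        (hFs.contMDiffAt ((isOpen_interiorSource c).mem_nhds hxN)).mdifferentiableAt (by simp)
      have hd2 := Φ.mdifferentiableAt_lift hwT
      have hcomp := mfderiv_comp w hd1 hd2
      have heq : F ∘ Φ.lift c =ᶠ[𝓝 w] fun w : E n => ‖w‖ ^ 2 - ρ ^ 2 := by
        have : Φ.toFun ⁻¹' ((extChartAt (𝓡∂ (n + 1)) c).target ∩ {y : E n | 0 < y 0}) ∈ 𝓝 w :=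
          ((isOpen_target_inter c).preimage Φ.contDiff.continuous).mem_nhds ⟨hwT, Φ.pos w⟩
        filter_upwards [this] with z hz
        simp only [Function.comp, hF, Φ.coord_lift hz.1]
      have h1 : HasFDerivAt (fun w : E n => ‖w‖ ^ 2 - ρ ^ 2) (2 • innerSL ℝ w) w :=
        ((hasStrictFDerivAt_norm_sq w).hasFDerivAt).sub_const _
      have h2 := (h1.congr_of_eventuallyEq heq).hasMFDerivAt.mfderiv
      rw [h2, hzero] at hcomp
      have h3 := DFunLike.congr_fun hcomp w
      have h4 : (2 • innerSL ℝ w : E n →L[ℝ] ℝ) w = 0 := h3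
      simp at h4
      rw [h4] at hwρ
      simp at hwρ
      exact hρ.ne hwρ
    · rw [Φ.lift_image_eq hs']
      ext y
      simp only [mem_inter_iff, mem_preimage, Metric.mem_ball, dist_zero_right, mem_ofPred_eq, hF,
        sub_neg]
      rw [sq_lt_sq₀ (norm_nonneg _) hρ.le]
      tauto

lemma isTestFunction_extend [CompactSpace Xbar] {f : E n → ℝ} (hf : ContDiff ℝ ∞ f)
    {ρ ρ' : ℝ} (hρ : ρ < ρ')
    (hsupp : Function.support f ⊆ Metric.closedBall 0 ρ)
    (hs : ∀ w ∈ Metric.closedBall (0 : E n) ρ, Φ.toFun w ∈ (extChartAt (𝓡∂ (n + 1)) c).target) :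
    IsTestFunction n (Φ.lift c '' Metric.ball 0 ρ') (Φ.extend c f) := by
  have hK := (Φ.isCompact_lift_image hs).isClosed
  have hKN : Φ.lift c '' Metric.closedBall 0 ρ ⊆ interiorSource n c := by
    rintro _ ⟨w, hw, rfl⟩
    exact Φ.lift_mem (hs w hw)
  have hzero : ∀ x, x ∉ Φ.lift c '' Metric.closedBall 0 ρ → Φ.extend c f x = 0 := by
    intro x hx
    by_cases hxN : x ∈ interiorSource n c
    · rw [extend, if_pos hxN]
      by_contra h
      exact hx ⟨_, hsupp h, Φ.lift_coord hxN⟩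
    · rw [extend, if_neg hxN]
  refine ⟨fun x => ?_, HasCompactSupport.of_compactSpace _, ?_⟩
  · by_cases hxN : x ∈ interiorSource n c
    · have h1 : ContMDiffAt (𝓡∂ (n + 1)) 𝓘(ℝ, ℝ) ∞ (f ∘ Φ.coord c) x :=
        hf.contMDiff.contMDiffAt.comp x
          (Φ.contMDiffOn_coord.contMDiffAt ((isOpen_interiorSource c).mem_nhds hxN))
      exact h1.congr_of_eventuallyEq (Φ.extend_eventuallyEq hxN)
    · have hx : (Φ.lift c '' Metric.closedBall 0 ρ)ᶜ ∈ 𝓝 x :=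
        hK.isOpen_compl.mem_nhds fun h => hxN (hKN h)
      refine (contMDiffAt_const (c := (0 : ℝ))).congr_of_eventuallyEq ?_
      filter_upwards [hx] with y hy using hzero y hy
  · have : tsupport (Φ.extend c f) ⊆ Φ.lift c '' Metric.closedBall 0 ρ :=
      closure_minimal (fun x hx => by_contra fun h => hx (hzero x h)) hK
    exact this.trans (image_mono (Metric.closedBall_subset_ball hρ))

variable [MeasurableSpace Xbar] [BorelSpace Xbar]

lemma lintegral_vol_le (g : BilinField n Xbar) {ρ : ℝ} (hρ : 0 < ρ)
    (hs : ∀ w ∈ Metric.closedBall (0 : E n) ρ, Φ.toFun w ∈ (extChartAt (𝓡∂ (n + 1)) c).target)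
    {D : E n → ℝ≥0∞} (hD : Measurable D)
    (hle : ∀ w ∈ Metric.ball (0 : E n) ρ,
      ENNReal.ofReal |(fderiv ℝ Φ.toFun w).det| * volDensity g c (Φ.toFun w) ≤ D w)
    (F : Xbar → ℝ≥0∞) :
    ∫⁻ x in Φ.lift c '' Metric.ball 0 ρ, F x ∂(vol g) ≤
      ∫⁻ w in Metric.ball 0 ρ, D w * F (Φ.lift c w) := by
  have h := vol_restrict_image g c (Φ := Φ.toFun) (Φ' := fderiv ℝ Φ.toFun)
    (measurableSet_ball (x := (0 : E n)) (ε := ρ)) (fun w _ => Φ.hasFDerivAt w)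
    Φ.injective.injOn (fun w hw => ⟨hs w (Metric.ball_subset_closedBall hw), Φ.pos w⟩)
    (Φ.isSmoothBoundedDomain_lift hρ hs).isOpen.measurableSet
  change (vol g).restrict (Φ.lift c '' Metric.ball 0 ρ) = Measure.map (Φ.lift c) _ at h
  rw [h]
  refine (lintegral_map_le _ _).trans ?_
  have hmono : (volume.restrict (Metric.ball (0 : E n) ρ)).withDensity
      (fun w => ENNReal.ofReal |(fderiv ℝ Φ.toFun w).det| * volDensity g c (Φ.toFun w)) ≤
      (volume.restrict (Metric.ball (0 : E n) ρ)).withDensity D :=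
    withDensity_mono (ae_restrict_of_forall_mem measurableSet_ball hle)
  exact (lintegral_mono' hmono le_rfl).trans (lintegral_withDensity_le_lintegral_mul _ hD _)

lemma le_lintegral_vol (g : BilinField n Xbar) {ρ : ℝ} (hρ : 0 < ρ)
    (hs : ∀ w ∈ Metric.closedBall (0 : E n) ρ, Φ.toFun w ∈ (extChartAt (𝓡∂ (n + 1)) c).target)
    {D : E n → ℝ≥0∞} (hD : Measurable D)
    (hle : ∀ w ∈ Metric.ball (0 : E n) ρ,
      D w ≤ ENNReal.ofReal |(fderiv ℝ Φ.toFun w).det| * volDensity g c (Φ.toFun w))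
    {F : Xbar → ℝ≥0∞} (hF : Measurable F) :
    ∫⁻ w in Metric.ball 0 ρ, D w * F (Φ.lift c w) ≤
      ∫⁻ x in Φ.lift c '' Metric.ball 0 ρ, F x ∂(vol g) := by
  have hs' : ∀ w ∈ Metric.ball (0 : E n) ρ, Φ.toFun w ∈ (extChartAt (𝓡∂ (n + 1)) c).target :=
    fun w hw => hs w (Metric.ball_subset_closedBall hw)
  have h := vol_restrict_image g c (Φ := Φ.toFun) (Φ' := fderiv ℝ Φ.toFun)
    (measurableSet_ball (x := (0 : E n)) (ε := ρ)) (fun w _ => Φ.hasFDerivAt w)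
    Φ.injective.injOn (fun w hw => ⟨hs' w hw, Φ.pos w⟩)
    (Φ.isSmoothBoundedDomain_lift hρ hs).isOpen.measurableSet
  change (vol g).restrict (Φ.lift c '' Metric.ball 0 ρ) = Measure.map (Φ.lift c) _ at h
  have hl : AEMeasurable (Φ.lift c) (volume.restrict (Metric.ball (0 : E n) ρ)) :=
    (Φ.continuousOn_lift hs').aemeasurable measurableSet_ball
  rw [h, lintegral_map' hF.aemeasurable (hl.mono_ac (withDensity_absolutelyContinuous _ _))]
  have hmono : (volume.restrict (Metric.ball (0 : E n) ρ)).withDensity D ≤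
      (volume.restrict (Metric.ball (0 : E n) ρ)).withDensity
      (fun w => ENNReal.ofReal |(fderiv ℝ Φ.toFun w).det| * volDensity g c (Φ.toFun w)) :=
    withDensity_mono (ae_restrict_of_forall_mem measurableSet_ball hle)
  refine le_trans (le_of_eq ?_) (lintegral_mono' hmono le_rfl)
  exact (lintegral_withDensity_eq_lintegral_mul₀ hD.aemeasurable
    (hF.comp_aemeasurable hl)).symm

/-- An upper bound for the first eigenvalue from a test function given in coordinates. -/
lemma firstEigenvalue_le [CompactSpace Xbar] (g : BilinField n Xbar) {p : ℝ} (hp : 0 < p)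
    {f : E n → ℝ}
    (hf : ContDiff ℝ ∞ f) {ρ ρ' : ℝ} (hρ : ρ < ρ') (hρ' : 0 < ρ')
    (hsupp : Function.support f ⊆ Metric.closedBall 0 ρ)
    (hs : ∀ w ∈ Metric.closedBall (0 : E n) ρ', Φ.toFun w ∈ (extChartAt (𝓡∂ (n + 1)) c).target)
    {D₁ D₂ : E n → ℝ≥0∞} (hD₁ : Measurable D₁) (hD₂ : Measurable D₂)
    (hle₁ : ∀ w ∈ Metric.ball (0 : E n) ρ',
      D₁ w ≤ ENNReal.ofReal |(fderiv ℝ Φ.toFun w).det| * volDensity g c (Φ.toFun w))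
    (hle₂ : ∀ w ∈ Metric.ball (0 : E n) ρ',
      ENNReal.ofReal |(fderiv ℝ Φ.toFun w).det| * volDensity g c (Φ.toFun w) ≤ D₂ w)
    {m : E n → ℝ} (hm : ∀ w ∈ Metric.ball (0 : E n) ρ', ∀ ξ : E n,
      chartInner g c (Φ.toFun w) (fderiv ℝ Φ.toFun w ξ) (fderiv ℝ Φ.toFun w ξ) ≤ 1 →
      |fderiv ℝ f w ξ| ≤ m w)
    (h0 : ∫⁻ w in Metric.ball 0 ρ', D₁ w * ‖f w‖ₑ ^ p ≠ 0) :
    firstEigenvalue g p ≤ (∫⁻ w in Metric.ball 0 ρ', D₂ w * ENNReal.ofReal (m w) ^ p) /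
      ∫⁻ w in Metric.ball 0 ρ', D₁ w * ‖f w‖ₑ ^ p := by
  have hs' : ∀ w ∈ Metric.ball (0 : E n) ρ', Φ.toFun w ∈ (extChartAt (𝓡∂ (n + 1)) c).target :=
    fun w hw => hs w (Metric.ball_subset_closedBall hw)
  set Ω := Φ.lift c '' Metric.ball 0 ρ' with hΩ
  set φ := Φ.extend c f with hφ
  have hdom : IsSmoothBoundedDomain n Ω := Φ.isSmoothBoundedDomain_lift hρ' hs
  have htest : IsTestFunction n Ω φ := Φ.isTestFunction_extend hf hρ hsupp
    fun w hw => hs w (Metric.closedBall_subset_closedBall hρ.le hw)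
  have hφm : Measurable φ := htest.1.continuous.measurable
  have hnum : ∫⁻ x in Ω, covNorm g x (diff φ x) ^ p ∂(vol g) ≤
      ∫⁻ w in Metric.ball 0 ρ', D₂ w * ENNReal.ofReal (m w) ^ p := by
    refine (Φ.lintegral_vol_le g hρ' hs hD₂ hle₂ _).trans ?_
    refine setLIntegral_mono' measurableSet_ball fun w hw => ?_
    gcongr
    exact Φ.covNorm_diff_extend_le g hf (hs' w hw) (hm w hw)
  have hden : ∫⁻ w in Metric.ball 0 ρ', D₁ w * ‖f w‖ₑ ^ p ≤ ∫⁻ x in Ω, ‖φ x‖ₑ ^ p ∂(vol g) := by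
    refine le_trans (le_of_eq ?_) (Φ.le_lintegral_vol g hρ' hs hD₁ hle₁
      (F := fun x => ‖φ x‖ₑ ^ p) (hφm.enorm.pow_const p))
    refine setLIntegral_congr_fun measurableSet_ball fun w hw => ?_
    simp only [hφ, Φ.extend_lift (hs' w hw)]
  have hcov0 : ∀ x : Xbar, covNorm g x (diff φ x - diff φ x) = 0 := by
    intro x
    simp [covNorm]
  have hW : MemW0 g p Ω φ (diff φ) := by
    refine ⟨hφm.aemeasurable, fun _ => φ, fun _ => htest, ?_, fun _ => ?_, ?_⟩
    · simp [ENNReal.zero_rpow_of_pos hp]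
    · simp only [hcov0]
      exact aemeasurable_const
    · simp only [hcov0, ENNReal.zero_rpow_of_pos hp, lintegral_zero]
      exact tendsto_const_nhds
  refine (iInf₂_le Ω hdom).trans ?_
  refine (iInf₂_le_of_le φ (diff φ) (iInf₂_le_of_le hW ?_ le_rfl)).trans
    (ENNReal.div_le_div hnum hden)
  exact fun h => h0 (le_antisymm (hden.trans h.le) zero_le)

end HalfSpaceDiffeo

end Transport

/-! ### Logarithmic coordinates near a boundary point -/

section Stretch

variable {n : ℕ}

/-- The map `w ↦ (exp (L (w⁰ - 2)), w¹, …, wⁿ)` of Euclidean space onto the upper half-space. -/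
noncomputable def expHeight (L : ℝ) (w : E n) : E n := w + (Real.exp (L * (w 0 - 2)) - w 0) • e 0

lemma add_smul_expHeight_zero {y₀ : E n} (hy₀ : y₀ 0 = 0) (σ L : ℝ) (w : E n) :
    (y₀ + σ • expHeight L w) 0 = σ * Real.exp (L * (w 0 - 2)) := by
  simp [expHeight, e, hy₀]
  ring

/-- The coordinates `w` on the half-space in which the point `y₀ + σ (t, w¹, …, wⁿ)` with
`t = exp (L (w⁰ - 2))` is described by `w`; here `y₀` lies on the boundary of the half-space.
The parameter `σ` is the size of the neighbourhood of `y₀` covered by a ball of fixed radius; in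
the half-space model it acts by a hyperbolic isometry. -/
noncomputable def logDiffeo (y₀ : E n) (hy₀ : y₀ 0 = 0) {σ L : ℝ} (hσ : 0 < σ) (hL : 0 < L) :
    HalfSpaceDiffeo n where
  toFun w := y₀ + σ • expHeight L w
  inv y := σ⁻¹ • (y - y₀) + (2 + Real.log (σ⁻¹ * y 0) / L - σ⁻¹ * y 0) • e 0
  contDiff := by
    unfold expHeight
    fun_prop
  contDiffOn_inv := by
    intro y hy
    have h : σ⁻¹ * y 0 ≠ 0 := (mul_pos (inv_pos.2 hσ) hy).ne'
    have h0 : ContDiff ℝ ∞ fun y : E n => y 0 := by fun_prop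
    have h1 : ContDiffAt ℝ ∞ (fun y : E n => Real.log (σ⁻¹ * y 0)) y :=
      (contDiffAt_const.mul h0.contDiffAt).log h
    exact (ContDiffAt.add (by fun_prop) (ContDiffAt.smul
      (((contDiffAt_const.add (h1.div_const L)).sub (contDiffAt_const.mul h0.contDiffAt)))
      contDiffAt_const)).contDiffWithinAt
  pos w := by
    rw [add_smul_expHeight_zero hy₀]
    positivity
  left_inv w := by
    have h : σ⁻¹ * (y₀ + σ • expHeight L w) 0 = Real.exp (L * (w 0 - 2)) := by
      rw [add_smul_expHeight_zero hy₀, inv_mul_cancel_left₀ hσ.ne']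
    simp only [h, Real.log_exp, add_sub_cancel_left, smul_smul, inv_mul_cancel₀ hσ.ne', one_smul]
    rw [mul_div_cancel_left₀ _ hL.ne', expHeight, add_assoc, ← add_smul]
    simp
  right_inv y hy := by
    have h : 0 < σ⁻¹ * y 0 := mul_pos (inv_pos.2 hσ) hy
    set w : E n := σ⁻¹ • (y - y₀) + (2 + Real.log (σ⁻¹ * y 0) / L - σ⁻¹ * y 0) • e 0 with hw
    have h0 : w 0 = 2 + Real.log (σ⁻¹ * y 0) / L := by
      simp [hw, e, hy₀]
    have h1 : Real.exp (L * (w 0 - 2)) = σ⁻¹ * y 0 := by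
      rw [h0, add_sub_cancel_left, mul_div_cancel₀ _ hL.ne', Real.exp_log h]
    rw [expHeight, h1, h0, hw, add_assoc, ← add_smul]
    simp [smul_smul, hσ.ne']

lemma logDiffeo_apply (y₀ : E n) (hy₀ : y₀ 0 = 0) {σ L : ℝ} (hσ : 0 < σ) (hL : 0 < L) (w : E n) :
    (logDiffeo y₀ hy₀ hσ hL).toFun w = y₀ + σ • expHeight L w := rfl

/-- The derivative of `expHeight L`. -/
noncomputable def dExpHeight (L : ℝ) (w : E n) : E n →L[ℝ] E n :=
  ContinuousLinearMap.id ℝ (E n) +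
    ((L * Real.exp (L * (w 0 - 2)) - 1) • (EuclideanSpace.proj 0 : E n →L[ℝ] ℝ)).smulRight (e 0)

lemma dExpHeight_apply (L : ℝ) (w ξ : E n) :
    dExpHeight L w ξ = ξ + ((L * Real.exp (L * (w 0 - 2)) - 1) * ξ 0) • e 0 := by
  simp [dExpHeight]

lemma hasFDerivAt_coord_zero (w : E n) :
    HasFDerivAt (fun w : E n => w 0) (EuclideanSpace.proj 0 : E n →L[ℝ] ℝ) w :=
  (EuclideanSpace.proj 0 : E n →L[ℝ] ℝ).hasFDerivAt

lemma hasFDerivAt_exp_coord (a : ℝ) (w : E n) :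
    HasFDerivAt (fun w : E n => Real.exp (a * (w 0 - 2)))
      ((a * Real.exp (a * (w 0 - 2))) • (EuclideanSpace.proj 0 : E n →L[ℝ] ℝ)) w := by
  have h := (((hasFDerivAt_coord_zero w).sub_const 2).const_mul a).exp
  convert! h using 1
  rw [smul_smul, mul_comm]

lemma hasFDerivAt_expHeight (L : ℝ) (w : E n) :
    HasFDerivAt (expHeight L) (dExpHeight L w) w := by
  have h := (hasFDerivAt_id w).add
    (((hasFDerivAt_exp_coord L w).sub (hasFDerivAt_coord_zero w)).smul_const (e 0 : E n))
  convert! h using 1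
  rw [dExpHeight, sub_smul, one_smul]

lemma fderiv_logDiffeo (y₀ : E n) (hy₀ : y₀ 0 = 0) {σ L : ℝ} (hσ : 0 < σ) (hL : 0 < L) (w : E n) :
    fderiv ℝ (logDiffeo y₀ hy₀ hσ hL).toFun w = σ • dExpHeight L w :=
  (((hasFDerivAt_expHeight L w).const_smul σ).const_add y₀).fderiv

lemma det_fderiv_logDiffeo (y₀ : E n) (hy₀ : y₀ 0 = 0) {σ L : ℝ} (hσ : 0 < σ) (hL : 0 < L)
    (w : E n) : (fderiv ℝ (logDiffeo y₀ hy₀ hσ hL).toFun w).det =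
      σ ^ (n + 1) * (L * Real.exp (L * (w 0 - 2))) := by
  rw [fderiv_logDiffeo]
  set a := L * Real.exp (L * (w 0 - 2)) with ha
  have h : LinearMap.toMatrix (EuclideanSpace.basisFun (Fin (n + 1)) ℝ).toBasis
      (EuclideanSpace.basisFun (Fin (n + 1)) ℝ).toBasis
      ((σ • dExpHeight L w : E n →L[ℝ] E n) : E n →ₗ[ℝ] E n) =
      Matrix.diagonal fun i => if i = 0 then σ * a else σ := by
    ext i j
    rw [LinearMap.toMatrix_apply, Matrix.diagonal_apply]
    have : (EuclideanSpace.basisFun (Fin (n + 1)) ℝ).toBasis j = e j := by simp [e]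
    rw [this]
    simp only [ContinuousLinearMap.coe_coe, smul_apply, dExpHeight_apply, ← ha]
    simp only [e, OrthonormalBasis.coe_toBasis_repr_apply, EuclideanSpace.basisFun_repr]
    by_cases hij : i = j
    · subst hij
      by_cases hi : i = 0
      · subst hi; simp; ring
      · simp [hi]
    · by_cases hj : j = 0
      · subst hj; simp [hij]
      · simp [hij, Ne.symm hj]
  rw [ContinuousLinearMap.det, ← LinearMap.det_toMatrix
    (EuclideanSpace.basisFun (Fin (n + 1)) ℝ).toBasis, h, Matrix.det_diagonal,
    Fin.prod_univ_succ]
  simp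
  ring

lemma norm_e (i : Fin (n + 1)) : ‖(e i : E n)‖ = 1 := by simp [e]

lemma norm_expHeight_le {L : ℝ} (hL : 0 < L) {w : E n} (hw : ‖w‖ ≤ 2) : ‖expHeight L w‖ ≤ 5 := by
  have h0 : |w 0| ≤ 2 := (PiLp.norm_apply_le w 0).trans hw
  have h1 : Real.exp (L * (w 0 - 2)) ≤ 1 := by
    rw [Real.exp_le_one_iff]
    nlinarith [(abs_le.1 h0).2]
  have h2 := Real.exp_pos (L * (w 0 - 2))
  calc ‖expHeight L w‖ ≤ ‖w‖ + ‖(Real.exp (L * (w 0 - 2)) - w 0) • (e 0 : E n)‖ := norm_add_le _ _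
    _ ≤ 2 + 3 := by
      rw [norm_smul, norm_e, mul_one, Real.norm_eq_abs]
      refine add_le_add hw (abs_le.2 ⟨?_, ?_⟩) <;> linarith [(abs_le.1 h0).1, (abs_le.1 h0).2]
    _ = 5 := by norm_num

lemma norm_le_dExpHeight {L : ℝ} (w ξ : E n) :
    ‖ξ‖ ≤ 2 * ‖dExpHeight L w ξ‖ + |ξ 0| := by
  have h1 : ξ = dExpHeight L w ξ - (dExpHeight L w ξ 0) • e 0 + ξ 0 • e 0 := by
    rw [dExpHeight_apply]
    ext i
    by_cases hi : i = 0
    · subst hi; simp [e]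
    · simp [e, hi]
  have h2 : |dExpHeight L w ξ 0| ≤ ‖dExpHeight L w ξ‖ :=
    PiLp.norm_apply_le (dExpHeight L w ξ) 0
  calc ‖ξ‖ = ‖dExpHeight L w ξ - (dExpHeight L w ξ 0) • e 0 + ξ 0 • e 0‖ := by rw [← h1]
    _ ≤ ‖dExpHeight L w ξ‖ + ‖(dExpHeight L w ξ 0) • (e 0 : E n)‖ + ‖ξ 0 • (e 0 : E n)‖ :=
      (norm_add_le _ _).trans (add_le_add (norm_sub_le _ _) le_rfl)
    _ ≤ _ := by
      rw [norm_smul, norm_smul, norm_e, mul_one, mul_one, Real.norm_eq_abs, Real.norm_eq_abs]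
      linarith

end Stretch

/-! ### The metric near a boundary point -/

section Asymptotics

variable {n : ℕ} {Xbar : Type*} [TopologicalSpace Xbar]
  [ChartedSpace (EuclideanHalfSpace (n + 1)) Xbar]

lemma chartInner_smul (g : BilinField n Xbar) (c : Xbar) (y v : E n) (a : ℝ) :
    chartInner g c y (a • v) (a • v) = a ^ 2 * chartInner g c y v v := by
  simp only [chartInner, Finset.mul_sum, PiLp.smul_apply, smul_eq_mul]
  exact Finset.sum_congr rfl fun i _ => Finset.sum_congr rfl fun j _ => by ring

lemma chartInner_eq_div {g g' : BilinField n Xbar} {c : Xbar} {y : E n} {s : ℝ}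
    (h : ∀ i j, coeff g c i j y = coeff g' c i j y / s ^ 2) (u v : E n) :
    chartInner g c y u v = chartInner g' c y u v / s ^ 2 := by
  simp only [chartInner, Finset.sum_div, h]
  exact Finset.sum_congr rfl fun i _ => Finset.sum_congr rfl fun j _ => by ring

lemma abs_chartInner_sub_le (g : BilinField n Xbar) (c : Xbar) (y y' v : E n) :
    |chartInner g c y v v - chartInner g c y' v v| ≤
      (∑ i, ∑ j, |coeff g c i j y - coeff g c i j y'|) * ‖v‖ ^ 2 := by
  simp only [chartInner, ← Finset.sum_sub_distrib, Finset.sum_mul]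
  refine (Finset.abs_sum_le_sum_abs _ _).trans (Finset.sum_le_sum fun i _ => ?_)
  refine (Finset.abs_sum_le_sum_abs _ _).trans (Finset.sum_le_sum fun j _ => ?_)
  rw [← sub_mul, ← sub_mul, abs_mul, abs_mul, mul_assoc, sq]
  have hi : |v i| ≤ ‖v‖ := PiLp.norm_apply_le v i
  have hj : |v j| ≤ ‖v‖ := PiLp.norm_apply_le v j
  gcongr

variable [IsManifold (𝓡∂ (n + 1)) ∞ Xbar]

local notation "GBar" => Bundle.ContMDiffRiemannianMetric (𝓡∂ (n + 1)) 2 (E n)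
      (TangentSpace (𝓡∂ (n + 1)) : Xbar → Type _)

lemma exists_norm_sq_le_chartInner (gbar : GBar) {c : Xbar} {y : E n}
    (hy : y ∈ (extChartAt (𝓡∂ (n + 1)) c).target) :
    ∃ C : ℝ, 0 < C ∧ ∀ v : E n, ‖v‖ ^ 2 ≤ C ^ 2 * chartInner gbar.inner c y v v := by
  have hcont : Continuous fun v : E n => chartInner gbar.inner c y v v := by
    unfold chartInner
    fun_prop
  obtain ⟨v₀, hv₀, hmin⟩ := (isCompact_sphere (0 : E n) 1).exists_isMinOn
    ⟨e 0, by simp [norm_e]⟩ hcont.continuousOn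
  have hv₀n : ‖v₀‖ = 1 := by simpa using hv₀
  have hpos := chartInner_pos gbar hy (v := v₀) (by rintro rfl; simp at hv₀n)
  set μ := chartInner gbar.inner c y v₀ v₀ with hμ
  refine ⟨(Real.sqrt μ)⁻¹, by positivity, fun v => ?_⟩
  rw [inv_pow, Real.sq_sqrt hpos.le, ← div_eq_inv_mul, le_div_iff₀ hpos]
  rcases eq_or_ne v 0 with rfl | hv
  · simp [chartInner]
  · have hv' : 0 < ‖v‖ := norm_pos_iff.2 hv
    have h1 : μ ≤ chartInner gbar.inner c y (‖v‖⁻¹ • v) (‖v‖⁻¹ • v) :=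
      hmin (by simp [norm_smul, hv'.ne'])
    rw [chartInner_smul, inv_pow, ← div_eq_inv_mul, le_div_iff₀ (by positivity)] at h1
    linarith

lemma eventually_chartInner_le (gbar : GBar) {c : Xbar} {y₀ : E n}
    (hy₀ : y₀ ∈ (extChartAt (𝓡∂ (n + 1)) c).target) {ε : ℝ} (hε : 0 < ε) :
    ∀ᶠ y in 𝓝[(extChartAt (𝓡∂ (n + 1)) c).target] y₀, ∀ v,
      chartInner gbar.inner c y₀ v v ≤ (1 + ε) * chartInner gbar.inner c y v v := by
  obtain ⟨C, hC, hCv⟩ := exists_norm_sq_le_chartInner gbar hy₀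
  have hlim : Tendsto (fun y => ∑ i, ∑ j, |coeff gbar.inner c i j y - coeff gbar.inner c i j y₀|)
      (𝓝[(extChartAt (𝓡∂ (n + 1)) c).target] y₀) (𝓝 0) := by
    have : ContinuousOn
        (fun y => ∑ i, ∑ j, |coeff gbar.inner c i j y - coeff gbar.inner c i j y₀|)
        (extChartAt (𝓡∂ (n + 1)) c).target := by
      have h : ∀ i j, ContinuousOn (coeff gbar.inner c i j)
          (extChartAt (𝓡∂ (n + 1)) c).target := fun i j =>
        (coeff_contDiffOn gbar c i j).continuousOn
      fun_prop
    simpa [ContinuousWithinAt] using this y₀ hy₀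
  have hpos : 0 < ε / (1 + ε) / C ^ 2 := by positivity
  filter_upwards [hlim.eventually_lt_const hpos] with y hy v
  have h1 := abs_le.1 (abs_chartInner_sub_le gbar.inner c y y₀ v)
  have h2 := hCv v
  have h3 : (∑ i, ∑ j, |coeff gbar.inner c i j y - coeff gbar.inner c i j y₀|) * ‖v‖ ^ 2 ≤
      ε / (1 + ε) / C ^ 2 * (C ^ 2 * chartInner gbar.inner c y₀ v v) := by
    gcongr
  have h4 : ε / (1 + ε) / C ^ 2 * (C ^ 2 * chartInner gbar.inner c y₀ v v) =
      ε / (1 + ε) * chartInner gbar.inner c y₀ v v := by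
    field_simp
  rw [h4] at h3
  have h5 : (1 - ε / (1 + ε)) * chartInner gbar.inner c y₀ v v ≤ chartInner gbar.inner c y v v := by
    linarith [h1.1]
  have h6 : 1 - ε / (1 + ε) = (1 + ε)⁻¹ := by
    field_simp
    ring
  rw [h6, inv_mul_le_iff₀ (by positivity)] at h5
  exact h5

lemma eventually_sqrt_det (gbar : GBar) {c : Xbar} {y₀ : E n}
    (hy₀ : y₀ ∈ (extChartAt (𝓡∂ (n + 1)) c).target) {ε : ℝ} (hε : 0 < ε) :
    ∀ᶠ y in 𝓝[(extChartAt (𝓡∂ (n + 1)) c).target] y₀,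
      (1 + ε)⁻¹ * √(gram gbar.inner c y₀).det ≤ √(gram gbar.inner c y).det ∧
      √(gram gbar.inner c y).det ≤ (1 + ε) * √(gram gbar.inner c y₀).det := by
  have hpos : 0 < √(gram gbar.inner c y₀).det := Real.sqrt_pos.2 (gram_posDef gbar hy₀).det_pos
  have hcont : ContinuousWithinAt (fun y => √(gram gbar.inner c y).det)
      (extChartAt (𝓡∂ (n + 1)) c).target y₀ := by
    have h : ∀ i j, ContinuousOn (coeff gbar.inner c i j)
        (extChartAt (𝓡∂ (n + 1)) c).target := fun i j =>
      (coeff_contDiffOn gbar c i j).continuousOn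
    have h' : ContinuousOn (fun y => (gram gbar.inner c y).det)
        (extChartAt (𝓡∂ (n + 1)) c).target := by
      simp only [Matrix.det_apply', gram, Matrix.of_apply]
      fun_prop
    exact (Real.continuous_sqrt.comp_continuousOn h') y₀ hy₀
  have h1 : (1 + ε)⁻¹ * √(gram gbar.inner c y₀).det < √(gram gbar.inner c y₀).det := by
    rw [inv_mul_lt_iff₀ (by positivity)]
    nlinarith
  have h2 : √(gram gbar.inner c y₀).det < (1 + ε) * √(gram gbar.inner c y₀).det := by nlinarith
  filter_upwards [hcont.eventually_const_lt h1, hcont.eventually_lt_const h2] with y hy1 hy2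
    using ⟨hy1.le, hy2.le⟩

/-- Quantitative control of the conformal factor and of the compactified metric near a boundary
point. -/
lemma exists_ball_control {r : Xbar → ℝ} (hr : IsDefiningFunction n r) (gbar : GBar) {x : Xbar}
    (hx : x ∈ (𝓡∂ (n + 1)).boundary Xbar) {b : ℝ}
    (hb : ∀ v : E n, fderivWithin ℝ (r ∘ (extChartAt (𝓡∂ (n + 1)) x).symm)
      (extChartAt (𝓡∂ (n + 1)) x).target (extChartAt (𝓡∂ (n + 1)) x x) v = b * v 0)
    {ε ε' : ℝ} (hε : 0 < ε) (hε' : 0 < ε') :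
    ∃ δ : ℝ, 0 < δ ∧ ∀ y : E n, ‖y - extChartAt (𝓡∂ (n + 1)) x x‖ < δ → 0 < y 0 →
      y ∈ (extChartAt (𝓡∂ (n + 1)) x).target ∧
      |(r ∘ (extChartAt (𝓡∂ (n + 1)) x).symm) y - b * y 0| ≤
        ε' * ‖y - extChartAt (𝓡∂ (n + 1)) x x‖ ∧
      (∀ v, chartInner gbar.inner x (extChartAt (𝓡∂ (n + 1)) x x) v v ≤
        (1 + ε) * chartInner gbar.inner x y v v) ∧
      ((1 + ε)⁻¹ * √(gram gbar.inner x (extChartAt (𝓡∂ (n + 1)) x x)).det ≤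
        √(gram gbar.inner x y).det ∧
      √(gram gbar.inner x y).det ≤
        (1 + ε) * √(gram gbar.inner x (extChartAt (𝓡∂ (n + 1)) x x)).det) := by
  set y₀ := extChartAt (𝓡∂ (n + 1)) x x with hy₀
  set T := (extChartAt (𝓡∂ (n + 1)) x).target with hT
  set f := r ∘ (extChartAt (𝓡∂ (n + 1)) x).symm with hf
  have hyT : y₀ ∈ T := mem_extChartAt_target x
  have hy00 : y₀ 0 = 0 := extChartAt_self_apply_zero hx
  have hr0 : f y₀ = 0 := by
    simp only [hf, Function.comp, hy₀, extChartAt_to_inv]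
    exact hr.zero x hx
  have hd : HasFDerivWithinAt f (fderivWithin ℝ f T y₀) T y₀ :=
    ((defining_contDiffOn hr x).differentiableOn (by norm_num) y₀ hyT).hasFDerivWithinAt
  have hlit : ∀ᶠ y in 𝓝[T] y₀, |f y - b * y 0| ≤ ε' * ‖y - y₀‖ := by
    filter_upwards [hd.isLittleO.def hε'] with y hy
    rw [hb, hr0, sub_zero, PiLp.sub_apply, hy00, sub_zero, Real.norm_eq_abs] at hy
    exact hy
  have hall := (hlit.and ((eventually_chartInner_le gbar hyT hε).and
    (eventually_sqrt_det gbar hyT hε)))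
  have hTn : 𝓝[T] y₀ = 𝓝[range (𝓡∂ (n + 1))] y₀ := nhdsWithin_extChartAt_target_eq x
  have hall' := (eventually_mem_nhdsWithin (a := y₀) (s := T)).and hall
  rw [hTn, eventually_nhdsWithin_iff, Metric.eventually_nhds_iff] at hall'
  obtain ⟨δ, hδ, h⟩ := hall'
  refine ⟨δ, hδ, fun y hy hy0 => h (by rwa [dist_eq_norm]) ?_⟩
  rw [range_modelWithCornersEuclideanHalfSpace]
  exact hy0.le

end Asymptotics

/-! ### The Rayleigh quotient of the model test function -/

section Rayleigh

variable {n : ℕ}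

/-- The coordinate expression of the test function: the power `t ^ q` of the height
`t = exp (L (w⁰ - 2))`, cut off by a bump function in the logarithmic coordinates. -/
noncomputable def powBump (q L : ℝ) (B : ContDiffBump (0 : E n)) (w : E n) : ℝ :=
  Real.exp (q * L * (w 0 - 2)) * B w

lemma contDiff_powBump (q L : ℝ) (B : ContDiffBump (0 : E n)) : ContDiff ℝ ∞ (powBump q L B) := by
  unfold powBump
  have h : ContDiff ℝ ∞ fun w : E n => w 0 := by fun_prop
  exact ((contDiff_const.mul (h.sub contDiff_const)).exp).mul B.contDiff

lemma fderiv_powBump (q L : ℝ) (B : ContDiffBump (0 : E n)) (w ξ : E n) :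
    fderiv ℝ (powBump q L B) w ξ =
      Real.exp (q * L * (w 0 - 2)) * (q * B w * (L * ξ 0) + fderiv ℝ B w ξ) := by
  have hB : HasFDerivAt B (fderiv ℝ B w) w :=
    ((B.contDiff (n := 1)).differentiable (by norm_num) w).hasFDerivAt
  have h := ((hasFDerivAt_exp_coord (q * L) w).mul hB).fderiv
  have h' : fderiv ℝ (powBump q L B) w = _ := h
  rw [h']
  simp
  ring

lemma sqrt_inv_sq_smul_det (A : Matrix (Fin (n + 1)) (Fin (n + 1)) ℝ) {s : ℝ} (hs : 0 < s) :
    √((s ^ 2)⁻¹ • A).det = (s⁻¹) ^ (n + 1) * √A.det := by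
  rw [Matrix.det_smul, Fintype.card_fin, ← inv_pow, ← pow_mul, mul_comm 2, pow_mul,
    Real.sqrt_mul (by positivity), Real.sqrt_sq (by positivity)]

/-- For large `L` the contribution of the derivative of the bump function to the gradient of the
test function is negligible; `M` bounds that derivative, and `a exp (-L) + 1 / L` bounds the
coordinate length of a unit vector. -/
lemma exists_log_scale {M a η : ℝ} (hM : 0 ≤ M) (ha : 0 ≤ a) (hη : 0 < η) :
    ∃ L : ℝ, 0 < L ∧ M * (a * Real.exp (-L) + 1 / L) ≤ η := by
  have hL : 0 < M * (a + 1) / η + 1 := by positivity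
  refine ⟨M * (a + 1) / η + 1, hL, ?_⟩
  set L : ℝ := M * (a + 1) / η + 1 with hLdef
  have h1 : Real.exp (-L) ≤ 1 / L := by
    rw [Real.exp_neg, ← one_div]
    exact one_div_le_one_div_of_le hL (by linarith [Real.add_one_le_exp L])
  calc M * (a * Real.exp (-L) + 1 / L) ≤ M * (a * (1 / L) + 1 / L) := by gcongr
    _ = M * (a + 1) / L := by ring
    _ ≤ η := by
      have h2 : η * L = M * (a + 1) + η := by
        rw [hLdef]
        field_simp
      rw [div_le_iff₀ hL, h2]
      linarith

/-- The differential of the test function, evaluated on a vector `ξ` whose image under the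
derivative of the coordinates has length at most `(1 + η)² b t` for the quadratic form `H`. The
inequality `(b v⁰)² ≤ H v` bounds the component of `ξ` along the height; the other components
are of size `O(t)` and do not matter in the limit. -/
lemma abs_fderiv_powBump_le {B : ContDiffBump (0 : E n)} (hB1 : B.rOut = 1) {H : E n → ℝ}
    {q L b C M η : ℝ} (hq : 0 ≤ q) (hL : 0 < L) (hb : 0 < b) (hC : 0 < C) (hη : 0 < η)
    (hM : ∀ w, ‖fderiv ℝ B w‖ ≤ M) (hLη : M * (2 * C * b * Real.exp (-L) + 1 / L) ≤ η)
    (hbH : ∀ v, (b * v 0) ^ 2 ≤ H v) (hCH : ∀ v, ‖v‖ ^ 2 ≤ C ^ 2 * H v) {w ξ : E n}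
    (hξ : H (dExpHeight L w ξ) ≤ ((1 + η) ^ 2 * (b * Real.exp (L * (w 0 - 2)))) ^ 2) :
    |fderiv ℝ (powBump q L B) w ξ| ≤
      Real.exp (q * L * (w 0 - 2)) * ((1 + η) ^ 2 * (q * B w + η)) := by
  set t := Real.exp (L * (w 0 - 2)) with ht
  have ht0 : 0 < t := Real.exp_pos _
  set ζ := dExpHeight L w ξ with hζ
  have hζ0 : ζ 0 = L * t * ξ 0 := by
    rw [hζ, dExpHeight_apply, ← ht]
    simp [e]
    ring
  have hξ0 : |L * ξ 0| ≤ (1 + η) ^ 2 := by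
    have h6 := abs_le_of_sq_le_sq ((hbH ζ).trans hξ) (by positivity)
    rw [hζ0, show b * (L * t * ξ 0) = (b * t) * (L * ξ 0) by ring, abs_mul,
      abs_of_pos (by positivity : 0 < b * t), mul_comm ((1 + η) ^ 2)] at h6
    exact le_of_mul_le_mul_left h6 (by positivity)
  have hζn : ‖ζ‖ ≤ C * ((1 + η) ^ 2 * (b * t)) := by
    refine le_of_sq_le_sq ?_ (by positivity)
    rw [mul_pow]
    exact (hCH ζ).trans (by gcongr)
  have hdB : |fderiv ℝ B w ξ| ≤ (1 + η) ^ 2 * η := by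
    by_cases hw1 : ‖w‖ ≤ 1
    · have ht1 : t ≤ Real.exp (-L) := by
        rw [ht, Real.exp_le_exp]
        have : |w 0| ≤ 1 := (PiLp.norm_apply_le w 0).trans hw1
        nlinarith [(abs_le.1 this).2]
      have h8 : |ξ 0| ≤ (1 + η) ^ 2 * (1 / L) := by
        rw [mul_one_div, le_div_iff₀ hL, mul_comm, ← abs_of_pos hL, ← abs_mul]
        simpa [abs_of_pos hL] using hξ0
      have h9 : ‖ξ‖ ≤ (1 + η) ^ 2 * (2 * C * b * Real.exp (-L) + 1 / L) := by
        calc ‖ξ‖ ≤ 2 * ‖ζ‖ + |ξ 0| := norm_le_dExpHeight w ξ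
          _ ≤ 2 * (C * ((1 + η) ^ 2 * (b * Real.exp (-L)))) + (1 + η) ^ 2 * (1 / L) := by
            gcongr
            exact hζn.trans (by gcongr)
          _ = _ := by ring
      have hM0 : 0 ≤ M := (norm_nonneg _).trans (hM 0)
      calc |fderiv ℝ B w ξ| ≤ ‖fderiv ℝ B w‖ * ‖ξ‖ := (fderiv ℝ B w).le_opNorm ξ
        _ ≤ M * ((1 + η) ^ 2 * (2 * C * b * Real.exp (-L) + 1 / L)) := by
          gcongr
          exact hM w
        _ = (1 + η) ^ 2 * (M * (2 * C * b * Real.exp (-L) + 1 / L)) := by ring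
        _ ≤ _ := by gcongr
    · have : fderiv ℝ B w = 0 := by
        refine fderiv_of_notMem_tsupport ℝ ?_
        rw [B.tsupport_eq, hB1]
        simpa using hw1
      rw [this]
      simp
      positivity
  rw [fderiv_powBump, abs_mul, abs_of_pos (Real.exp_pos _)]
  refine mul_le_mul_of_nonneg_left ?_ (Real.exp_pos _).le
  have hBn := B.nonneg (x := w)
  calc |q * B w * (L * ξ 0) + fderiv ℝ B w ξ| ≤ |q * B w * (L * ξ 0)| + |fderiv ℝ B w ξ| :=
      abs_add_le _ _
    _ ≤ q * B w * (1 + η) ^ 2 + (1 + η) ^ 2 * η := by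
      rw [abs_mul, abs_of_nonneg (by positivity)]
      gcongr
    _ = _ := by ring

/-- The volume density of the model, `t⁻ⁿ` up to a constant, and with an arbitrary factor. -/
noncomputable def modelDensity (n : ℕ) (K L a : ℝ) (w : E n) : ℝ≥0∞ :=
  ENNReal.ofReal (a ^ (n + 2) * K * Real.exp (-(n * L * (w 0 - 2))))

lemma measurable_modelDensity (K L a : ℝ) : Measurable (modelDensity n K L a) := by
  have : Continuous fun w : E n => a ^ (n + 2) * K * Real.exp (-(n * L * (w 0 - 2))) := by
    fun_prop
  exact this.measurable.ennreal_ofReal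

lemma modelDensity_mul_rpow {K L a p q u : ℝ} (hK : 0 ≤ K) (ha : 0 ≤ a) (hp : 0 < p)
    (hqp : q * p = n) (hu : 0 ≤ u) (w : E n) :
    modelDensity n K L a w * ENNReal.ofReal (Real.exp (q * L * (w 0 - 2)) * u) ^ p =
      ENNReal.ofReal K * (ENNReal.ofReal (a ^ (n + 2)) * ENNReal.ofReal (u ^ p)) := by
  have he : Real.exp (-(n * L * (w 0 - 2))) * Real.exp (q * L * (w 0 - 2)) ^ p = 1 := by
    rw [← Real.exp_mul, ← Real.exp_add, ← hqp]
    ring_nf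
    exact Real.exp_zero
  rw [ENNReal.ofReal_rpow_of_nonneg (by positivity) hp.le, modelDensity,
    ← ENNReal.ofReal_mul (by positivity), ← ENNReal.ofReal_mul (by positivity),
    ← ENNReal.ofReal_mul (by positivity), Real.mul_rpow (Real.exp_pos _).le hu]
  congr 1
  linear_combination a ^ (n + 2) * K * u ^ p * he

lemma volDensity_eq {Xbar : Type*} [TopologicalSpace Xbar]
    [ChartedSpace (EuclideanHalfSpace (n + 1)) Xbar] {g g' : BilinField n Xbar} {c : Xbar}
    {y : E n} {s : ℝ} (hs : 0 < s) (h : ∀ i j, coeff g c i j y = coeff g' c i j y / s ^ 2)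
    {b σ L : ℝ} (hb : 0 < b) (hσ : 0 < σ) (hL : 0 < L) (w : E n) :
    ENNReal.ofReal |σ ^ (n + 1) * (L * Real.exp (L * (w 0 - 2)))| * volDensity g c y =
      ENNReal.ofReal ((b * (σ * Real.exp (L * (w 0 - 2))) / s) ^ (n + 1) *
        (L / b ^ (n + 1)) * √(gram g' c y).det * Real.exp (-(n * L * (w 0 - 2)))) := by
  rw [volDensity, ← ENNReal.ofReal_mul (abs_nonneg _), gram_eq_of_coeff_eq h,
    sqrt_inv_sq_smul_det _ hs, abs_of_pos (by positivity)]
  congr 1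
  have hexp : Real.exp (-(n * L * (w 0 - 2))) = (Real.exp (L * (w 0 - 2)) ^ n)⁻¹ := by
    rw [← Real.exp_nat_mul, ← Real.exp_neg]
    ring_nf
  have ht := Real.exp_pos (L * (w 0 - 2))
  rw [hexp, div_pow, mul_pow, mul_pow, inv_pow]
  field_simp
  ring

/-- The estimates of `exists_ball_control` in the coordinates given by `logDiffeo`. -/
lemma exists_logDiffeo_control {Xbar : Type*} [TopologicalSpace Xbar]
    [ChartedSpace (EuclideanHalfSpace (n + 1)) Xbar] [IsManifold (𝓡∂ (n + 1)) ∞ Xbar]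
    {r : Xbar → ℝ} (hr : IsDefiningFunction n r)
    (gbar : Bundle.ContMDiffRiemannianMetric (𝓡∂ (n + 1)) 2 (E n)
      (TangentSpace (𝓡∂ (n + 1)) : Xbar → Type _)) {x : Xbar}
    (hx : x ∈ (𝓡∂ (n + 1)).boundary Xbar) {b : ℝ} (hb0 : 0 < b)
    (hb : ∀ v : E n, fderivWithin ℝ (r ∘ (extChartAt (𝓡∂ (n + 1)) x).symm)
      (extChartAt (𝓡∂ (n + 1)) x).target (extChartAt (𝓡∂ (n + 1)) x x) v = b * v 0)
    {η L : ℝ} (hη : 0 < η) (hL : 0 < L) :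
    ∃ (σ : ℝ) (hσ : 0 < σ), ∀ w ∈ Metric.closedBall (0 : E n) 2, ∀ y : E n,
      y = (logDiffeo _ (extChartAt_self_apply_zero hx) hσ hL).toFun w →
      y ∈ (extChartAt (𝓡∂ (n + 1)) x).target ∧
      (r ∘ (extChartAt (𝓡∂ (n + 1)) x).symm) y ≤
        (1 + η) * (b * (σ * Real.exp (L * (w 0 - 2)))) ∧
      b * (σ * Real.exp (L * (w 0 - 2))) ≤
        (1 + η) * (r ∘ (extChartAt (𝓡∂ (n + 1)) x).symm) y ∧
      (∀ v, chartInner gbar.inner x (extChartAt (𝓡∂ (n + 1)) x x) v v ≤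
        (1 + η) * chartInner gbar.inner x y v v) ∧
      ((1 + η)⁻¹ * √(gram gbar.inner x (extChartAt (𝓡∂ (n + 1)) x x)).det ≤
        √(gram gbar.inner x y).det ∧
      √(gram gbar.inner x y).det ≤
        (1 + η) * √(gram gbar.inner x (extChartAt (𝓡∂ (n + 1)) x x)).det) := by
  -- The height `t` is at least `exp (-4 L)` on the ball, so an error `ε' * (5 σ)` in `r` is small
  -- relative to `b σ t`.
  set ε' : ℝ := η / (1 + η) * b * Real.exp (-(4 * L)) / 5 with hε'
  have hε'0 : 0 < ε' := by positivity
  obtain ⟨δ, hδ, hloc⟩ := exists_ball_control hr gbar hx hb hη hε'0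
  -- A ball of radius `2` is mapped into the ball of radius `5 σ` about the boundary point.
  obtain ⟨σ, hσdef⟩ : ∃ σ, σ = δ / 6 := ⟨_, rfl⟩
  have hσ : 0 < σ := by rw [hσdef]; positivity
  refine ⟨σ, hσ, ?_⟩
  rintro w hw y rfl
  set Φ := logDiffeo _ (extChartAt_self_apply_zero hx) hσ hL with hΦ
  have hw2 : ‖w‖ ≤ 2 := by simpa using hw
  have hnorm : ‖Φ.toFun w - extChartAt (𝓡∂ (n + 1)) x x‖ ≤ 5 * σ := by
    rw [hΦ, logDiffeo_apply, add_sub_cancel_left, norm_smul, Real.norm_eq_abs, abs_of_pos hσ,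
      mul_comm]
    exact mul_le_mul_of_nonneg_right (norm_expHeight_le hL hw2) hσ.le
  have hΦ0 : Φ.toFun w 0 = σ * Real.exp (L * (w 0 - 2)) :=
    add_smul_expHeight_zero (extChartAt_self_apply_zero hx) σ L w
  obtain ⟨h1, h2, h3, h4⟩ := hloc (Φ.toFun w) (by linarith) (Φ.pos w)
  rw [hΦ0] at h2
  have ht : Real.exp (-(4 * L)) ≤ Real.exp (L * (w 0 - 2)) := by
    rw [Real.exp_le_exp]
    have : |w 0| ≤ 2 := (PiLp.norm_apply_le w 0).trans hw2
    nlinarith [(abs_le.1 this).1]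
  set t := Real.exp (L * (w 0 - 2)) with htdef
  have h5 : ε' * ‖Φ.toFun w - extChartAt (𝓡∂ (n + 1)) x x‖ ≤ η / (1 + η) * (b * (σ * t)) := by
    calc _ ≤ ε' * (5 * σ) := by gcongr
      _ = η / (1 + η) * (b * (σ * Real.exp (-(4 * L)))) := by rw [hε']; ring
      _ ≤ _ := by gcongr
  have h6 := abs_le.1 (h2.trans h5)
  have hbt : 0 < b * (σ * t) := by positivity
  refine ⟨h1, ?_, ?_, h3, h4⟩
  · have h7 : η / (1 + η) ≤ η := div_le_self hη.le (by linarith)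
    nlinarith [h6.2, mul_le_mul_of_nonneg_right h7 hbt.le]
  · have h8 : (1 + η) * (η / (1 + η) * (b * (σ * t))) = η * (b * (σ * t)) := by field_simp
    nlinarith [h6.1]

/-- The test function `t ^ q B` with `q = n / p` at a boundary point. The volume of `g` is
`K t⁻ⁿ dw` and the gradient is at most `t ^ q (q B + η)`, both up to powers of `1 + η`; the powers
of `t` and the constant `K` cancel in the quotient. -/
lemma firstEigenvalue_le_of_bump {Xbar : Type*} [TopologicalSpace Xbar] [T2Space Xbar]
    [CompactSpace Xbar] [ChartedSpace (EuclideanHalfSpace (n + 1)) Xbar]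
    [IsManifold (𝓡∂ (n + 1)) ∞ Xbar] [MeasurableSpace Xbar] [BorelSpace Xbar] (hn : 1 ≤ n)
    {g : BilinField n Xbar} (hcurv : CurvatureTendsToNegOne g) {r : Xbar → ℝ}
    (hr : IsDefiningFunction n r)
    {gbar : Bundle.ContMDiffRiemannianMetric (𝓡∂ (n + 1)) 2 (E n)
      (TangentSpace (𝓡∂ (n + 1)) : Xbar → Type _)}
    (hgr : ∀ x ∈ (𝓡∂ (n + 1)).interior Xbar,
      ∀ u v : TangentSpace (𝓡∂ (n + 1)) x, gbar.inner x u v = r x ^ 2 * g x u v)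
    {x : Xbar} (hx : x ∈ (𝓡∂ (n + 1)).boundary Xbar) {p : ℝ} (hp : 1 < p)
    (B : ContDiffBump (0 : E n)) (hB1 : B.rOut = 1)
    (hJ : ∫⁻ w in Metric.ball (0 : E n) 2, ENNReal.ofReal (B w ^ p) ≠ 0) {η : ℝ} (hη : 0 < η) :
    firstEigenvalue g p ≤
      (ENNReal.ofReal ((1 + η) ^ (n + 2) * ((1 + η) ^ 2) ^ p) *
        ∫⁻ w in Metric.ball (0 : E n) 2, ENNReal.ofReal ((n / p * B w + η) ^ p)) /
      (ENNReal.ofReal ((1 + η)⁻¹ ^ (n + 2)) *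
        ∫⁻ w in Metric.ball (0 : E n) 2, ENNReal.ofReal (B w ^ p)) := by
  obtain ⟨b, hb0, hb⟩ := exists_fderivWithin_defining hr hx
  have hdr := sq_fderivWithin_defining_le hn hcurv hr hgr hx hb
  set y₀ := extChartAt (𝓡∂ (n + 1)) x x with hy₀
  set T := (extChartAt (𝓡∂ (n + 1)) x).target with hT
  set f := r ∘ (extChartAt (𝓡∂ (n + 1)) x).symm with hf
  have hyT : y₀ ∈ T := mem_extChartAt_target x
  have hy00 : y₀ 0 = 0 := extChartAt_self_apply_zero hx
  obtain ⟨C, hC, hCv⟩ := exists_norm_sq_le_chartInner gbar hyT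
  have hp0 : 0 < p := by linarith
  have hη1 : 0 < 1 + η := by linarith
  set q : ℝ := n / p with hq
  have hq0 : 0 ≤ q := by positivity
  have hqp : q * p = n := by rw [hq]; field_simp
  -- A bound for the differential of the bump function.
  obtain ⟨M, hM⟩ := B.hasCompactSupport.fderiv (𝕜 := ℝ) |>.exists_bound_of_continuous
    ((B.contDiff (n := 1)).continuous_fderiv (by norm_num))
  have hM0 : 0 ≤ M := (norm_nonneg _).trans (hM 0)
  obtain ⟨L, hL, hLη⟩ := exists_log_scale hM0 (by positivity : 0 ≤ 2 * C * b) hη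
  obtain ⟨σ, hσ, hcontrol'⟩ := exists_logDiffeo_control hr gbar hx hb0 hb hη hL
  set Φ := logDiffeo y₀ hy00 hσ hL with hΦ
  have hcontrol := fun w hw => hcontrol' w hw (Φ.toFun w) rfl
  have hs : ∀ w ∈ Metric.closedBall (0 : E n) 2, Φ.toFun w ∈ T := fun w hw => (hcontrol w hw).1
  have hfpos : ∀ w ∈ Metric.closedBall (0 : E n) 2, 0 < f (Φ.toFun w) := fun w hw =>
    defining_pos hr (hs w hw) (Φ.pos w)
  have hcoeff : ∀ w ∈ Metric.closedBall (0 : E n) 2, ∀ i j, coeff g x i j (Φ.toFun w) =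
      coeff gbar.inner x i j (Φ.toFun w) / f (Φ.toFun w) ^ 2 := fun w hw i j =>
    coeff_eq_div hr hgr (hs w hw) (Φ.pos w) i j
  set S := √(gram gbar.inner x y₀).det with hS
  have hS0 : 0 < S := Real.sqrt_pos.2 (gram_posDef gbar hyT).det_pos
  set K : ℝ := L / b ^ (n + 1) * S with hK
  have hK0 : 0 < K := by positivity
  have hdens := fun w hw => volDensity_eq (hfpos w hw) (hcoeff w hw) hb0 hσ hL w
  have hquot : ∀ w ∈ Metric.ball (0 : E n) 2,
      (1 + η)⁻¹ ≤ b * (σ * Real.exp (L * (w 0 - 2))) / f (Φ.toFun w) ∧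
      b * (σ * Real.exp (L * (w 0 - 2))) / f (Φ.toFun w) ≤ 1 + η := by
    intro w hw
    have hw' := Metric.ball_subset_closedBall hw
    obtain ⟨-, h1, h2, -⟩ := hcontrol w hw'
    have hf0 := hfpos w hw'
    exact ⟨by rw [le_div_iff₀ hf0, inv_mul_le_iff₀ hη1]; exact h1, by rwa [div_le_iff₀ hf0]⟩
  have hle₁ : ∀ w ∈ Metric.ball (0 : E n) 2, modelDensity n K L (1 + η)⁻¹ w ≤
      ENNReal.ofReal |(fderiv ℝ Φ.toFun w).det| * volDensity g x (Φ.toFun w) := by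
    intro w hw
    rw [hΦ, det_fderiv_logDiffeo, ← hΦ, hdens w (Metric.ball_subset_closedBall hw)]
    obtain ⟨-, -, -, -, h4, -⟩ := hcontrol w (Metric.ball_subset_closedBall hw)
    obtain ⟨h5, -⟩ := hquot w hw
    have hf0 := hfpos w (Metric.ball_subset_closedBall hw)
    refine ENNReal.ofReal_le_ofReal ?_
    have : (1 + η)⁻¹ ^ (n + 2) * K = (1 + η)⁻¹ ^ (n + 1) * (L / b ^ (n + 1)) * ((1 + η)⁻¹ * S) := by
      rw [hK]; ring
    rw [this]
    gcongr ?_ * ?_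
    gcongr
  have hle₂ : ∀ w ∈ Metric.ball (0 : E n) 2,
      ENNReal.ofReal |(fderiv ℝ Φ.toFun w).det| * volDensity g x (Φ.toFun w) ≤
        modelDensity n K L (1 + η) w := by
    intro w hw
    rw [hΦ, det_fderiv_logDiffeo, ← hΦ, hdens w (Metric.ball_subset_closedBall hw)]
    obtain ⟨-, -, -, -, -, h4⟩ := hcontrol w (Metric.ball_subset_closedBall hw)
    obtain ⟨h3, h5⟩ := hquot w hw
    have h6 : 0 ≤ b * (σ * Real.exp (L * (w 0 - 2))) / f (Φ.toFun w) :=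
      (inv_nonneg.2 hη1.le).trans h3
    refine ENNReal.ofReal_le_ofReal ?_
    have : (1 + η) ^ (n + 2) * K = (1 + η) ^ (n + 1) * (L / b ^ (n + 1)) * ((1 + η) * S) := by
      rw [hK]; ring
    rw [this]
    gcongr
  set m : E n → ℝ := fun w =>
    Real.exp (q * L * (w 0 - 2)) * ((1 + η) ^ 2 * (q * B w + η)) with hm
  have hgrad : ∀ w ∈ Metric.ball (0 : E n) 2, ∀ ξ : E n,
      chartInner g x (Φ.toFun w) (fderiv ℝ Φ.toFun w ξ) (fderiv ℝ Φ.toFun w ξ) ≤ 1 →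
      |fderiv ℝ (powBump q L B) w ξ| ≤ m w := by
    intro w hw ξ hξ
    have hw' := Metric.ball_subset_closedBall hw
    obtain ⟨-, h1, -, h3, -⟩ := hcontrol w hw'
    have hf0 := hfpos w hw'
    rw [hΦ, fderiv_logDiffeo, ← hΦ, smul_apply, chartInner_smul,
      chartInner_eq_div (hcoeff w hw'), ← mul_div_assoc, div_le_one (by positivity)] at hξ
    refine abs_fderiv_powBump_le hB1 hq0 hL hb0 hC hη hM hLη hdr hCv ?_
    set t := Real.exp (L * (w 0 - 2)) with ht
    set ζ := dExpHeight L w ξ with hζ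
    have h4 : σ ^ 2 * chartInner gbar.inner x (Φ.toFun w) ζ ζ ≤
        σ ^ 2 * ((1 + η) * (b * t)) ^ 2 := by
      calc _ ≤ f (Φ.toFun w) ^ 2 := hξ
        _ ≤ ((1 + η) * (b * (σ * t))) ^ 2 := by gcongr
        _ = _ := by ring
    have h5 := le_of_mul_le_mul_left h4 (by positivity)
    calc _ ≤ (1 + η) * chartInner gbar.inner x (Φ.toFun w) ζ ζ := h3 ζ
      _ ≤ (1 + η) * ((1 + η) * (b * t)) ^ 2 := by gcongr
      _ ≤ (1 + η) ^ 2 * ((1 + η) * (b * t)) ^ 2 := by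
        gcongr
        nlinarith
      _ = _ := by ring
  -- In both integrands the powers of `t` cancel.
  have hden : ∫⁻ w in Metric.ball (0 : E n) 2,
      modelDensity n K L (1 + η)⁻¹ w * ‖powBump q L B w‖ₑ ^ p =
      ENNReal.ofReal K * (ENNReal.ofReal ((1 + η)⁻¹ ^ (n + 2)) *
        ∫⁻ w in Metric.ball (0 : E n) 2, ENNReal.ofReal (B w ^ p)) := by
    rw [← lintegral_const_mul' _ _ ENNReal.ofReal_ne_top,
      ← lintegral_const_mul' _ _ ENNReal.ofReal_ne_top]
    refine lintegral_congr fun w => ?_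
    have hBn := B.nonneg (x := w)
    rw [powBump, Real.enorm_of_nonneg (by positivity),
      modelDensity_mul_rpow hK0.le (by positivity) hp0 hqp hBn]
  have hnum : ∫⁻ w in Metric.ball (0 : E n) 2,
      modelDensity n K L (1 + η) w * ENNReal.ofReal (m w) ^ p =
      ENNReal.ofReal K * (ENNReal.ofReal ((1 + η) ^ (n + 2) * ((1 + η) ^ 2) ^ p) *
        ∫⁻ w in Metric.ball (0 : E n) 2, ENNReal.ofReal ((q * B w + η) ^ p)) := by
    rw [← lintegral_const_mul' _ _ ENNReal.ofReal_ne_top,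
      ← lintegral_const_mul' _ _ ENNReal.ofReal_ne_top]
    refine lintegral_congr fun w => ?_
    have hBn := B.nonneg (x := w)
    rw [modelDensity_mul_rpow hK0.le (by positivity) hp0 hqp (by positivity),
      Real.mul_rpow (by positivity) (by positivity),
      ENNReal.ofReal_mul (p := ((1 + η) ^ 2) ^ p) (by positivity),
      ENNReal.ofReal_mul (p := (1 + η) ^ (n + 2)) (by positivity), mul_assoc]
  have hKne : ENNReal.ofReal K ≠ 0 := by simpa using hK0
  have hsupp : Function.support (powBump q L B) ⊆ Metric.closedBall 0 1 := by
    intro w hw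
    have h1 : w ∈ Function.support B := fun h => hw (by simp [powBump, h])
    rw [B.support_eq, hB1] at h1
    exact Metric.ball_subset_closedBall h1
  have hmain := Φ.firstEigenvalue_le (c := x) g hp0 (contDiff_powBump q L B) (by norm_num)
    (by norm_num) hsupp hs (measurable_modelDensity K L _)
    (measurable_modelDensity K L _) hle₁ hle₂ hgrad (by
      rw [hden]
      refine mul_ne_zero hKne (mul_ne_zero ?_ hJ)
      simpa using by positivity)
  rwa [hnum, hden, ENNReal.mul_div_mul_left _ _ hKne ENNReal.ofReal_ne_top] at hmain

end Rayleigh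

/-! ### The limit of the Rayleigh quotients -/

section Limit

variable {n : ℕ}

lemma lintegral_bump_rpow_ne_zero (B : ContDiffBump (0 : E n)) {R p : ℝ} (hR : 0 < R)
    (hp : 0 < p) : ∫⁻ w in Metric.ball (0 : E n) R, ENNReal.ofReal (B w ^ p) ≠ 0 := by
  have hc : Continuous fun w => B w ^ p := B.continuous.rpow_const fun _ => Or.inr hp.le
  rw [← pos_iff_ne_zero, setLIntegral_pos_iff hc.measurable.ennreal_ofReal]
  refine (Metric.isOpen_ball (x := (0 : E n)) (ε := min B.rOut R)).measure_pos volume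
    ⟨0, Metric.mem_ball_self (lt_min B.rOut_pos hR)⟩ |>.trans_le (measure_mono fun w hw => ?_)
  have hw' : dist w 0 < min B.rOut R := hw
  rw [lt_min_iff] at hw'
  refine ⟨?_, hw'.2⟩
  have : 0 < B w := B.pos_of_mem_ball hw'.1
  simpa using by positivity

lemma tendsto_lintegral_bump (B : ContDiffBump (0 : E n)) {R p q : ℝ} (hp : 0 < p) (hq : 0 ≤ q) :
    Tendsto (fun η : ℝ => ∫⁻ w in Metric.ball (0 : E n) R, ENNReal.ofReal ((q * B w + η) ^ p))
      (𝓝[>] 0)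
      (𝓝 (ENNReal.ofReal (q ^ p) * ∫⁻ w in Metric.ball (0 : E n) R, ENNReal.ofReal (B w ^ p))) := by
  rw [← lintegral_const_mul' _ _ ENNReal.ofReal_ne_top]
  refine tendsto_lintegral_filter_of_dominated_convergence
    (fun _ => ENNReal.ofReal ((q + 1) ^ p)) ?_ ?_ ?_ ?_
  · refine Eventually.of_forall fun η => ?_
    have hc : Continuous fun w => (q * B w + η) ^ p :=
      ((continuous_const.mul B.continuous).add continuous_const).rpow_const fun _ => Or.inr hp.le
    exact hc.measurable.ennreal_ofReal
  · filter_upwards [Ioo_mem_nhdsGT (zero_lt_one (α := ℝ))] with η hη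
    refine Eventually.of_forall fun w => ENNReal.ofReal_le_ofReal ?_
    have h0 := B.nonneg (x := w)
    have h1 := B.le_one (x := w)
    have h2 := hη.1.le
    have h3 := hη.2.le
    refine Real.rpow_le_rpow (by positivity) ?_ hp.le
    nlinarith
  · rw [setLIntegral_const]
    exact ENNReal.mul_ne_top ENNReal.ofReal_ne_top measure_ball_lt_top.ne
  · refine Eventually.of_forall fun w => ?_
    rw [← ENNReal.ofReal_mul (by positivity), ← Real.mul_rpow hq B.nonneg]
    have hc : Continuous fun η : ℝ => ENNReal.ofReal ((q * B w + η) ^ p) :=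
      ENNReal.continuous_ofReal.comp
        ((continuous_const.add continuous_id).rpow_const fun _ => Or.inr hp.le)
    simpa using (hc.tendsto 0).mono_left nhdsWithin_le_nhds

lemma tendsto_rayleigh_bump (B : ContDiffBump (0 : E n)) {R p q : ℝ} (hR : 0 < R) (hp : 0 < p)
    (hq : 0 ≤ q) (m : ℕ) :
    Tendsto (fun η : ℝ => (ENNReal.ofReal ((1 + η) ^ m * ((1 + η) ^ 2) ^ p) *
        ∫⁻ w in Metric.ball (0 : E n) R, ENNReal.ofReal ((q * B w + η) ^ p)) /
      (ENNReal.ofReal ((1 + η)⁻¹ ^ m) *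
        ∫⁻ w in Metric.ball (0 : E n) R, ENNReal.ofReal (B w ^ p)))
      (𝓝[>] 0) (𝓝 (ENNReal.ofReal (q ^ p))) := by
  set J := ∫⁻ w in Metric.ball (0 : E n) R, ENNReal.ofReal (B w ^ p) with hJ
  have hJ0 : J ≠ 0 := lintegral_bump_rpow_ne_zero B hR hp
  have hJt : J ≠ ⊤ := by
    refine ((setLIntegral_mono measurable_const fun w _ => ?_).trans_lt
      (?_ : ∫⁻ _ in Metric.ball (0 : E n) R, 1 < ⊤)).ne
    · rw [ENNReal.ofReal_le_one]
      exact Real.rpow_le_one B.nonneg B.le_one hp.le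
    · rw [setLIntegral_one]
      exact measure_ball_lt_top
  have h1 : Tendsto (fun η : ℝ => ENNReal.ofReal ((1 + η) ^ m * ((1 + η) ^ 2) ^ p)) (𝓝[>] 0)
      (𝓝 1) := by
    have hc : Continuous fun η : ℝ => ENNReal.ofReal ((1 + η) ^ m * ((1 + η) ^ 2) ^ p) := by
      refine ENNReal.continuous_ofReal.comp (Continuous.mul (by fun_prop) ?_)
      exact Continuous.rpow_const (by fun_prop) fun _ => Or.inr hp.le
    simpa using (hc.tendsto 0).mono_left nhdsWithin_le_nhds
  have h2 : Tendsto (fun η : ℝ => ENNReal.ofReal ((1 + η)⁻¹ ^ m)) (𝓝[>] 0) (𝓝 1) := by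
    have hc : ContinuousAt (fun η : ℝ => (1 + η)⁻¹ ^ m) 0 := by
      refine ContinuousAt.pow (ContinuousAt.inv₀ (by fun_prop) (by norm_num)) m
    simpa [Function.comp_def] using (ENNReal.continuous_ofReal.continuousAt.comp hc).tendsto.mono_left
      nhdsWithin_le_nhds
  have h3 := ENNReal.Tendsto.mul h1 (Or.inl one_ne_zero) (tendsto_lintegral_bump B (R := R) hp hq)
    (Or.inr ENNReal.one_ne_top)
  have h4 := ENNReal.Tendsto.mul_const h2 (b := J) (Or.inr hJt)
  rw [← hJ, one_mul] at h3
  rw [one_mul] at h4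
  have h5 := ENNReal.Tendsto.div h3 (Or.inr hJ0) h4 (Or.inl hJt)
  rwa [ENNReal.mul_div_cancel_right hJ0 hJt] at h5

end Limit

end AHEigenvalue

theorem mainTheorem1 (n : ℕ) (hn : 1 ≤ n) {Xbar : Type*} [TopologicalSpace Xbar]
    [T2Space Xbar] [CompactSpace Xbar] [ChartedSpace (EuclideanHalfSpace (n + 1)) Xbar]
    [IsManifold (𝓡∂ (n + 1)) ∞ Xbar] [MeasurableSpace Xbar] [BorelSpace Xbar]
    (hM : ((𝓡∂ (n + 1)).boundary Xbar).Nonempty)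
    (g : AHEigenvalue.BilinField n Xbar) (hg : AHEigenvalue.IsAsymptoticallyHyperbolic g)
    (p : ℝ) (hp : 1 < p) :
    AHEigenvalue.firstEigenvalue g p ≤ ENNReal.ofReal (((n : ℝ) / p) ^ p) := by
  obtain ⟨r, gbar, hr, hgr⟩ := hg.conformallyCompact
  obtain ⟨x, hx⟩ := hM
  have hp0 : 0 < p := by linarith
  let B : ContDiffBump (0 : AHEigenvalue.E n) := ⟨1 / 2, 1, by norm_num, by norm_num⟩
  refine ge_of_tendsto (AHEigenvalue.tendsto_rayleigh_bump B two_pos hp0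
    (by positivity : (0 : ℝ) ≤ n / p) (n + 2)) ?_
  filter_upwards [self_mem_nhdsWithin] with η hη
  exact AHEigenvalue.firstEigenvalue_le_of_bump hn hg.curvature hr hgr hx hp B rfl
    (AHEigenvalue.lintegral_bump_rpow_ne_zero B two_pos hp0) hη
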